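/- Let $m\ge 0$, $n\ge 1$ and $\lambda\ge 1$ be integers, let $A\in\mathbb Z^{m\times n}$ have full row rank, and let $b\in\mathbb Z^m$. Let $\Delta_A$ be the largest absolute value of the determinant of an $m\times m$ submatrix of $A$. Consider the system $$Ax=b,\qquad \mathbf 0\le x\le\lambda\mathbf 1\qquad(x\in\mathbb R^n),$$ and suppose that it is either infeasible or has a strictly feasible solution, i.e. there is $\bar x\in\mathbb R^n$ with $A\bar x=b$ and $\mathbf 0<\bar x<\lambda\mathbf 1$. Then there exists an algorithm (one algorithm for all such instances) which, given $m,n,A,b,\lambda$ and $\Delta_A$, either returns a feasible solution of the system or correctly decides that the system is infeasible, with running time $$O\left(m^3+m^2n+n^2m+\left(2n\Delta_A\lambda\sqrt{2n+1}\right)^{\frac{1}{\log_2(7/5)}}\left(n^2+n\log\Delta_A+n\log\lambda\right)\right),$$ with an absolute implied constant. Here an algorithm is a fixed program of a random access machine with exact rational arithmetic ($+,-,\times,\div$ and comparisons, no rounding), and its running time is the number of executed operations, each of unit cost, including index arithmetic, memory accesses and control. -/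

import Mathlib

/-! ### A random access machine with exact rational arithmetic

Programs are finite objects, fixed independently of the input. The memory consists of index
registers `0, 1, 2, …`, each holding a natural number, and of two-dimensional arrays `0, 1, 2, …`,
whose cells hold rational numbers and are addressed by index terms. There is no rounding, and no
way to turn a rational number into an index. Every executed operation (index arithmetic, memory
access, rational arithmetic, comparison, assignment, control) has a positive unit cost. -/

namespace ArithRAM

/-- A memory configuration. -/
structure State where
  /-- the index registers -/
  idx : ℕ → ℕ
  /-- `arr a i j` is the cell `(i, j)` of the array number `a` -/
  arr : ℕ → ℕ → ℕ → ℚ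

/-- Index terms; `sub` is truncated subtraction. -/
inductive IdxTerm where
  | lit (k : ℕ)
  | var (x : ℕ)
  | add (e f : IdxTerm)
  | sub (e f : IdxTerm)

/-- The value of an index term. -/
def IdxTerm.eval (s : State) : IdxTerm → ℕ
  | lit k => k
  | var x => s.idx x
  | add e f => e.eval s + f.eval s
  | sub e f => e.eval s - f.eval s

/-- The number of operations performed in the evaluation of an index term. -/
def IdxTerm.cost : IdxTerm → ℕ
  | lit _ => 1
  | var _ => 1
  | add e f => e.cost + f.cost + 1
  | sub e f => e.cost + f.cost + 1

/-- Arithmetic terms; a division by zero returns zero. -/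
inductive RatTerm where
  | lit (q : ℚ)
  | get (a : ℕ) (i j : IdxTerm)
  | add (e f : RatTerm)
  | sub (e f : RatTerm)
  | mul (e f : RatTerm)
  | div (e f : RatTerm)

/-- The value of an arithmetic term. -/
def RatTerm.eval (s : State) : RatTerm → ℚ
  | lit q => q
  | get a i j => s.arr a (i.eval s) (j.eval s)
  | add e f => e.eval s + f.eval s
  | sub e f => e.eval s - f.eval s
  | mul e f => e.eval s * f.eval s
  | div e f => e.eval s / f.eval s

/-- The number of operations performed in the evaluation of an arithmetic term. -/
def RatTerm.cost : RatTerm → ℕ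
  | lit _ => 1
  | get _ i j => i.cost + j.cost + 1
  | add e f => e.cost + f.cost + 1
  | sub e f => e.cost + f.cost + 1
  | mul e f => e.cost + f.cost + 1
  | div e f => e.cost + f.cost + 1

/-- Comparisons of indices and of rational numbers. -/
inductive Test where
  | idxLt (e f : IdxTerm)
  | idxEq (e f : IdxTerm)
  | ratLt (e f : RatTerm)
  | ratEq (e f : RatTerm)

/-- The outcome of a comparison. -/
def Test.Holds (s : State) : Test → Prop
  | idxLt e f => e.eval s < f.eval s
  | idxEq e f => e.eval s = f.eval s
  | ratLt e f => e.eval s < f.eval s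
  | ratEq e f => e.eval s = f.eval s

/-- The number of operations performed in a comparison. -/
def Test.cost : Test → ℕ
  | idxLt e f => e.cost + f.cost + 1
  | idxEq e f => e.cost + f.cost + 1
  | ratLt e f => e.cost + f.cost + 1
  | ratEq e f => e.cost + f.cost + 1

/-- Programs. -/
inductive Program where
  /-- do nothing -/
  | nop
  /-- store the value of `e` in the index register `x` -/
  | setIdx (x : ℕ) (e : IdxTerm)
  /-- store the value of `e` in the cell `(i, j)` of the array `a` -/
  | setRat (a : ℕ) (i j : IdxTerm) (e : RatTerm)
  /-- run `p`, then `q` -/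
  | seq (p q : Program)
  /-- run `p` if the test succeeds, and `q` otherwise -/
  | branch (c : Test) (p q : Program)
  /-- run `p` again and again as long as the test succeeds -/
  | loop (c : Test) (p : Program)

/-- Overwrite the index register `x`. -/
def State.putIdx (s : State) (x k : ℕ) : State where
  idx := fun y => if y = x then k else s.idx y
  arr := s.arr

/-- Overwrite the cell `(i, j)` of the array `a`. -/
def State.putRat (s : State) (a i j : ℕ) (q : ℚ) : State where
  idx := s.idx
  arr := fun a' i' j' => if a' = a ∧ i' = i ∧ j' = j then q else s.arr a' i' j'

/-- `Run p s t s'`: the program `p`, started in the configuration `s`, halts in the configuration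
`s'` after exactly `t` operations. -/
inductive Run : Program → State → ℕ → State → Prop
  | nop (s : State) : Run .nop s 1 s
  | setIdx (s : State) (x : ℕ) (e : IdxTerm) :
      Run (.setIdx x e) s (e.cost + 1) (s.putIdx x (e.eval s))
  | setRat (s : State) (a : ℕ) (i j : IdxTerm) (e : RatTerm) :
      Run (.setRat a i j e) s (i.cost + j.cost + e.cost + 1)
        (s.putRat a (i.eval s) (j.eval s) (e.eval s))
  | seq {p q : Program} {s s₁ s₂ : State} {t u : ℕ} :
      Run p s t s₁ → Run q s₁ u s₂ → Run (.seq p q) s (t + u) s₂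
  | branch_true {c : Test} {p q : Program} {s s₁ : State} {t : ℕ} :
      c.Holds s → Run p s t s₁ → Run (.branch c p q) s (c.cost + t + 1) s₁
  | branch_false {c : Test} {p q : Program} {s s₁ : State} {t : ℕ} :
      ¬ c.Holds s → Run q s t s₁ → Run (.branch c p q) s (c.cost + t + 1) s₁
  | loop_stop {c : Test} {p : Program} {s : State} :
      ¬ c.Holds s → Run (.loop c p) s (c.cost + 1) s
  | loop_step {c : Test} {p : Program} {s s₁ s₂ : State} {t u : ℕ} :
      c.Holds s → Run p s t s₁ → Run (.loop c p) s₁ u s₂ →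
        Run (.loop c p) s (c.cost + 1 + t + u) s₂

end ArithRAM

/-! ### Bounded linear feasibility problems -/

namespace BoundedLP

/-- The solutions of `A x = b`, `0 ≤ x ≤ lam • 1` in `ℝⁿ`. -/
def feasibleSet {m n : ℕ} (A : Matrix (Fin m) (Fin n) ℤ) (b : Fin m → ℤ) (lam : ℕ) :
    Set (Fin n → ℝ) :=
  {x | (A.map (Int.cast : ℤ → ℝ)).mulVec x = (fun i => (b i : ℝ)) ∧
    ∀ j, 0 ≤ x j ∧ x j ≤ (lam : ℝ)}

/-- The solutions of `A x = b`, `0 < x < lam • 1` in `ℝⁿ`. -/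
def strictlyFeasibleSet {m n : ℕ} (A : Matrix (Fin m) (Fin n) ℤ) (b : Fin m → ℤ) (lam : ℕ) :
    Set (Fin n → ℝ) :=
  {x | (A.map (Int.cast : ℤ → ℝ)).mulVec x = (fun i => (b i : ℝ)) ∧
    ∀ j, 0 < x j ∧ x j < (lam : ℝ)}

/-- The largest absolute value of the determinant of an `m × m` submatrix of the `m × n` matrix `A`
(formed by `m` distinct columns). -/
noncomputable def maxSubdet {m n : ℕ} (A : Matrix (Fin m) (Fin n) ℤ) : ℕ :=
  (Finset.univ : Finset (Fin m ↪ Fin n)).sup fun f => (A.submatrix id f).det.natAbs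

/-- The input configuration: the index registers `0` and `1` hold `m` and `n`; array `0` holds `A`;
column `0` of array `1` holds `b`; the cells `(0, 0)` and `(0, 1)` of array `2` hold `lam` and the
maximum subdeterminant `Δ` of `A`; the rest of the memory is zero. -/
def inputState {m n : ℕ} (A : Matrix (Fin m) (Fin n) ℤ) (b : Fin m → ℤ) (lam Δ : ℕ) :
    ArithRAM.State where
  idx := fun x => if x = 0 then m else if x = 1 then n else 0
  arr := fun a i j =>
    if a = 0 then (if h : i < m ∧ j < n then (A ⟨i, h.1⟩ ⟨j, h.2⟩ : ℚ) else 0)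
    else if a = 1 then (if h : i < m ∧ j = 0 then (b ⟨i, h.1⟩ : ℚ) else 0)
    else if a = 2 then
      (if i = 0 ∧ j = 0 then (lam : ℚ) else if i = 0 ∧ j = 1 then (Δ : ℚ) else 0)
    else 0

/-- The verdict of a halted run: the index register `0` (`1`: a solution was found, `0`: the system
was declared infeasible). -/
def verdict (s : ArithRAM.State) : ℕ := s.idx 0

/-- The point returned by a halted run: the first `n` entries of column `0` of array `0`. -/
def returnedPoint (n : ℕ) (s : ArithRAM.State) : Fin n → ℝ := fun j => ((s.arr 0 j 0 : ℚ) : ℝ)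

/-- `m³ + m²n + n²m + (2nΔ·lam·√(2n+1))^(1 / log₂(7/5)) · (n² + n log Δ + n log lam)`. -/
noncomputable def timeBound (m n lam Δ : ℕ) : ℝ :=
  (m : ℝ) ^ 3 + (m : ℝ) ^ 2 * n + (n : ℝ) ^ 2 * m +
    (2 * n * Δ * lam * Real.sqrt (2 * n + 1)) ^ (1 / Real.logb 2 (7 / 5)) *
      ((n : ℝ) ^ 2 + n * Real.log Δ + n * Real.log lam)

end BoundedLP

/-! The exponent `1 / log₂(7/5)` is at least 2, because `(7/5)² < 2`. It is therefore enough to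
decide the system in `O(B²)` rounds of `O(n²)` operations, where `B = 2nΔλ√(2n+1)`, after a
preparation of `O(n²m + n)` operations. A relaxation method of Agmon–Motzkin type inside the affine
space `Ax = b` does this.

Vertices of the feasible polytope have denominators at most `Δ`, by Cramer's rule. If the system is
strictly feasible, then for each coordinate some vertex has that coordinate at least `1/Δ` and some
vertex has it at most `λ - 1/Δ`. The average of these `2n` vertices is a central solution: it keeps
distance at least `δ = 1/(2nΔ)` from all bounds (`exists_central_point`).

Gram–Schmidt applied to the rows of `A` yields the orthogonal projection `P` onto `ker A` and the
projection of the origin onto `Ax = b` (`IsPartialSolution.succ`). The squared distance from that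
point to a central `y` is at most `|y|² ≤ nλ²`. Whenever a coordinate violates a bound, a move along
the corresponding column of `P` brings it to distance `δ` inside that bound. This preserves `Ax = b`
and lowers the squared distance to every central point by at least `δ²` (`relaxation_step`).

Hence a central point rules out more than `(n+1)λ²/δ² ≤ B²` unsuccessful sweeps. A sweep without
violations has found a solution. If the budget runs out, no central point exists, so the system is
not strictly feasible and, by hypothesis, infeasible. -/

namespace BoundedLP

/-! ### Vertices of the feasible polytope and the central point -/

section Vertices

variable {m n : ℕ} {A : Matrix (Fin m) (Fin n) ℤ} {b : Fin m → ℤ} {lam : ℕ}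

/-- In a matrix of full row rank, independent columns extend to a nonsingular maximal minor. -/
theorem exists_det_ne_zero_of_linearIndepOn_col
    (hA : (A.map (Int.cast : ℤ → ℝ)).rank = m) {J : Set (Fin n)}
    (hJ : LinearIndepOn ℝ (A.map (Int.cast : ℤ → ℝ)).col J) :
    ∃ f : Fin m ↪ Fin n, J ⊆ Set.range f ∧ (A.submatrix id f).det ≠ 0 := by
  classical
  obtain ⟨B, -, hJB, hspan, hB⟩ := exists_linearIndepOn_extension hJ (Set.subset_univ J)
  -- A maximal independent set of columns is a basis of the column space, whose dimension is the
  -- rank.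
  have hcard : Fintype.card B = m := by
    rw [← finrank_span_eq_card hB]
    refine Eq.trans ?_ hA
    rw [Matrix.rank_eq_finrank_span_cols]
    suffices h : Submodule.span ℝ (Set.range fun x : B => (A.map (Int.cast : ℤ → ℝ)).col x) =
        Submodule.span ℝ (Set.range (A.map (Int.cast : ℤ → ℝ)).col) by rw [h]
    apply le_antisymm
    · exact Submodule.span_mono (by rintro _ ⟨x, rfl⟩; exact ⟨x, rfl⟩)
    · rw [Submodule.span_le, ← Set.image_univ]
      refine hspan.trans ?_
      rw [Set.image_eq_range]
  let e : Fin m ≃ B := (Fintype.equivFinOfCardEq hcard).symm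
  refine ⟨e.toEmbedding.trans (Function.Embedding.subtype _), fun j hj => ?_, ?_⟩
  · exact ⟨e.symm ⟨j, hJB hj⟩, by simp⟩
  · intro h0
    have hli : LinearIndependent ℝ
        ((A.map (Int.cast : ℤ → ℝ)).submatrix id fun i => (e i : Fin n)).col :=
      LinearIndependent.comp hB e e.injective
    rw [Matrix.linearIndependent_cols_iff_isUnit, Matrix.isUnit_iff_isUnit_det] at hli
    apply hli.ne_zero
    have := congrArg (Int.castRingHom ℝ) h0
    rw [RingHom.map_det, map_zero] at this
    exact this

theorem natAbs_det_le_maxSubdet (f : Fin m ↪ Fin n) :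
    (A.submatrix id f).det.natAbs ≤ maxSubdet A :=
  Finset.le_sup (f := fun f : Fin m ↪ Fin n => (A.submatrix id f).det.natAbs) (Finset.mem_univ f)

theorem one_le_maxSubdet (hA : (A.map (Int.cast : ℤ → ℝ)).rank = m) : 1 ≤ maxSubdet A := by
  obtain ⟨f, -, hf⟩ := exists_det_ne_zero_of_linearIndepOn_col hA (J := ∅) (by simp)
  exact (Nat.one_le_iff_ne_zero.2 (by simpa using hf)).trans (natAbs_det_le_maxSubdet f)

theorem sum_submatrix_eq {R : Type*} [Semiring R] (f : Fin m ↪ Fin n) (M : Fin n → R)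
    (u : Fin n → R) (hu : ∀ j, j ∉ Set.range f → u j = 0) :
    ∑ l, M (f l) * u (f l) = ∑ j, M j * u j :=
  Fintype.sum_of_injective f f.injective _ _ (fun j hj => by simp [hu j hj]) fun _ => rfl

/-- The rows of a matrix of full row rank can be separated by rational vectors. -/
theorem exists_mulVec_eq_single (hA : (A.map (Int.cast : ℤ → ℝ)).rank = m) (i : Fin m) :
    ∃ w : Fin n → ℚ, (A.map (Int.cast : ℤ → ℚ)).mulVec w = Pi.single i 1 := by
  classical
  obtain ⟨f, -, hf⟩ := exists_det_ne_zero_of_linearIndepOn_col hA (J := ∅) (by simp)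
  set M : Matrix (Fin m) (Fin m) ℚ := (A.map (Int.cast : ℤ → ℚ)).submatrix id f with hM
  have hdet : IsUnit M.det := by
    rw [isUnit_iff_ne_zero]
    have : M.det = ((A.submatrix id f).det : ℚ) := ((Int.castRingHom ℚ).map_det _).symm
    rw [this]; exact_mod_cast hf
  refine ⟨Function.extend f (M⁻¹.mulVec (Pi.single i 1)) 0, ?_⟩
  have h1 : M.mulVec (M⁻¹.mulVec (Pi.single i 1)) = Pi.single i 1 := by
    rw [Matrix.mulVec_mulVec, Matrix.mul_nonsing_inv _ hdet, Matrix.one_mulVec]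
  refine Eq.trans ?_ h1
  ext k
  generalize M⁻¹.mulVec (Pi.single i 1) = u
  simp only [Matrix.mulVec, dotProduct]
  rw [← sum_submatrix_eq f]
  · simp [hM, f.injective.extend_apply]
  · intro j hj
    rw [Function.extend_apply' _ _ _ (by simpa using hj)]; rfl

theorem isCompact_feasibleSet : IsCompact (feasibleSet A b lam) := by
  have hI : IsCompact (Set.Icc (0 : Fin n → ℝ) fun _ => (lam : ℝ)) := isCompact_Icc
  refine hI.of_isClosed_subset ?_ fun x hx => ⟨fun j => (hx.2 j).1, fun j => (hx.2 j).2⟩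
  simp only [feasibleSet, Set.ofPred_and, Set.ofPred_forall]
  refine IsClosed.inter ?_ (isClosed_iInter fun j => IsClosed.inter ?_ ?_)
  · exact isClosed_eq (Continuous.matrix_mulVec continuous_const continuous_id) continuous_const
  · exact isClosed_le continuous_const (continuous_apply j)
  · exact isClosed_le (continuous_apply j) continuous_const

theorem convex_feasibleSet : Convex ℝ (feasibleSet A b lam) := by
  intro x hx y hy s t hs ht hst
  refine ⟨?_, fun j => ?_⟩
  · rw [Matrix.mulVec_add, Matrix.mulVec_smul, Matrix.mulVec_smul, hx.1, hy.1, ← add_smul, hst,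
      one_smul]
  · exact convex_Icc (0 : ℝ) lam (hx.2 j) (hy.2 j) hs ht hst

/-- A kernel vector `l` supported on the coordinates strictly between the bounds can be added and
subtracted in small multiples without leaving the polytope. An extreme point is not the midpoint of
such a segment unless `l = 0`. -/
theorem linearIndepOn_col_of_mem_extremePoints {v : Fin n → ℝ}
    (hv : v ∈ (feasibleSet A b lam).extremePoints ℝ) :
    LinearIndepOn ℝ (A.map (Int.cast : ℤ → ℝ)).col {j | 0 < v j ∧ v j < lam} := by
  classical
  rw [linearIndepOn_iff]
  intro l hl hl0
  have hker : (A.map (Int.cast : ℤ → ℝ)).mulVec l = 0 := by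
    rw [← hl0, Finsupp.linearCombination_apply, Finsupp.sum_fintype _ _ (by simp)]
    ext i
    simp [Matrix.mulVec, dotProduct, mul_comm]
  have hev : ∀ c : ℝ, ∀ᶠ ε in nhdsWithin (0 : ℝ) (Set.Ioi 0),
      v + (ε * c) • (l : Fin n → ℝ) ∈ feasibleSet A b lam := by
    intro c
    have : ∀ᶠ ε in nhdsWithin (0 : ℝ) (Set.Ioi 0),
        ∀ j, 0 ≤ v j + ε * c * l j ∧ v j + ε * c * l j ≤ lam := by
      rw [Filter.eventually_all]
      intro j
      by_cases hj : 0 < v j ∧ v j < lam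
      · have ht : Filter.Tendsto (fun ε : ℝ => v j + ε * c * l j) (nhdsWithin 0 (Set.Ioi 0))
            (nhds (v j)) := by
          have : Continuous fun ε : ℝ => v j + ε * c * l j := by fun_prop
          simpa using (this.tendsto 0).mono_left nhdsWithin_le_nhds
        filter_upwards [ht.eventually (Ioo_mem_nhds hj.1 hj.2)] with ε hε
        exact ⟨hε.1.le, hε.2.le⟩
      · have : l j = 0 := by
          by_contra h
          exact hj (hl (by simpa using h))
        exact Filter.Eventually.of_forall fun ε => by simpa [this] using hv.1.2 j
    filter_upwards [this] with ε hε
    refine ⟨?_, hε⟩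
    rw [Matrix.mulVec_add, Matrix.mulVec_smul, hker, smul_zero, add_zero, hv.1.1]
  obtain ⟨ε, ⟨h1, h2⟩, hε⟩ := (((hev 1).and (hev (-1))).and self_mem_nhdsWithin).exists
  have hε' : (ε : ℝ) ≠ 0 := ne_of_gt hε
  have := hv.2 h1 h2 ⟨1 / 2, 1 / 2, by norm_num, by norm_num, by norm_num, by
    ext j; simp; ring⟩
  ext j
  have := congrFun this j
  simpa [hε'] using this

/-- Cramer's rule: the extreme points of the feasible set have denominators bounded by the maximal
minors. -/
theorem exists_det_mul_eq_intCast (hA : (A.map (Int.cast : ℤ → ℝ)).rank = m) {v : Fin n → ℝ}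
    (hv : v ∈ (feasibleSet A b lam).extremePoints ℝ) :
    ∃ d : ℕ, 1 ≤ d ∧ d ≤ maxSubdet A ∧ ∀ j, ∃ z : ℤ, d * v j = z := by
  classical
  obtain ⟨f, hJ, hf⟩ :=
    exists_det_ne_zero_of_linearIndepOn_col hA (linearIndepOn_col_of_mem_extremePoints hv)
  set D := (A.submatrix id f).det with hD
  -- Coordinates outside the chosen minor sit at a bound, hence are integers.
  have hN : ∀ j, j ∉ Set.range f → ∃ z : ℤ, v j = z := by
    intro j hj
    have hj' : ¬ (0 < v j ∧ v j < lam) := fun h => hj (hJ h)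
    rcases (hv.1.2 j).1.eq_or_lt with h | h
    · exact ⟨0, by simp [← h]⟩
    · refine ⟨lam, ?_⟩
      push_cast
      exact le_antisymm (hv.1.2 j).2 (not_lt.1 fun h' => hj' ⟨h, h'⟩)
  choose! z hz using hN
  set u : Fin n → ℝ := fun j => if j ∈ Set.range f then v j else 0 with hu
  -- Right-hand side left after moving the integral coordinates across; the remaining square system
  -- has integer data.
  set c : Fin m → ℤ := fun i => b i - ∑ j, A i j * (if j ∈ Set.range f then 0 else z j) with hc
  have hBu : ((A.submatrix id f).map (Int.cast : ℤ → ℝ)).mulVec (fun l => v (f l)) =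
      fun i => (c i : ℝ) := by
    ext i
    have h1 := congrFun hv.1.1 i
    have h2 : ∑ l, (A i (f l) : ℝ) * u (f l) = ∑ j, (A i j : ℝ) * u j :=
      sum_submatrix_eq f (fun j => (A i j : ℝ)) u (fun j hj => by simp only [hu, if_neg hj])
    have h3 : ∑ j, (A i j : ℝ) * v j = ∑ j, (A i j : ℝ) * u j +
        ∑ j, (A i j : ℝ) * (if j ∈ Set.range f then 0 else z j : ℤ) := by
      rw [← Finset.sum_add_distrib]
      refine Finset.sum_congr rfl fun j _ => ?_
      by_cases hj : j ∈ Set.range f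
      · simp only [hu, if_pos hj]; simp
      · simp only [hu, if_neg hj, hz j hj]; simp
    simp only [Matrix.mulVec, dotProduct, Matrix.map_apply, Matrix.submatrix_apply, id] at h1 ⊢
    have h4 : ∀ l, u (f l) = v (f l) := fun l => by simp [hu]
    simp only [h4] at h2
    rw [h2, hc]
    push_cast
    push_cast at h3
    linarith
  -- Multiplying by the adjugate instead of the inverse keeps everything integral.
  have hadj : ∀ l, (D : ℝ) * v (f l) = ((A.submatrix id f).adjugate.mulVec c l : ℤ) := by
    intro l
    have h1 := congrArg
      (((A.submatrix id f).map (Int.cast : ℤ → ℝ)).adjugate.mulVec) hBu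
    rw [Matrix.mulVec_mulVec, Matrix.adjugate_mul, Matrix.smul_mulVec, Matrix.one_mulVec] at h1
    have h2 : ((A.submatrix id f).map (Int.cast : ℤ → ℝ)).det = D :=
      ((Int.castRingHom ℝ).map_det _).symm
    have h3 : ((A.submatrix id f).map (Int.cast : ℤ → ℝ)).adjugate =
        (A.submatrix id f).adjugate.map (Int.cast : ℤ → ℝ) :=
      ((Int.castRingHom ℝ).map_adjugate _).symm
    have h4 := congrFun h1 l
    rw [h2, h3] at h4
    simp only [Pi.smul_apply, smul_eq_mul] at h4
    rw [h4]
    simp [Matrix.mulVec, dotProduct]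
  have hint : ∀ j, ∃ y : ℤ, (D : ℝ) * v j = y := by
    intro j
    by_cases hj : j ∈ Set.range f
    · obtain ⟨l, rfl⟩ := hj
      exact ⟨_, hadj l⟩
    · exact ⟨D * z j, by rw [hz j hj]; push_cast; rfl⟩
  refine ⟨D.natAbs, Nat.one_le_iff_ne_zero.2 (by simpa using hf), natAbs_det_le_maxSubdet f,
    fun j => ?_⟩
  obtain ⟨y, hy⟩ := hint j
  rcases Int.natAbs_eq D with h | h
  · refine ⟨y, ?_⟩
    rw [← hy]
    conv_rhs => rw [h]
    simp
  · refine ⟨-y, ?_⟩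
    push_cast
    rw [← hy]
    conv_rhs => rw [h]
    simp

/-- Krein–Milman: a bound `g ≤ c` on the extreme points would pass to their closed convex hull,
which is the whole polytope. -/
theorem exists_extremePoint_lt (g : (Fin n → ℝ) →ₗ[ℝ] ℝ)
    {y : Fin n → ℝ} (hy : y ∈ feasibleSet A b lam) {c : ℝ} (hc : c < g y) :
    ∃ v ∈ (feasibleSet A b lam).extremePoints ℝ, c < g v := by
  by_contra! h
  have h1 : closure (convexHull ℝ ((feasibleSet A b lam).extremePoints ℝ)) ⊆ {x | g x ≤ c} := by
    refine closure_minimal (convexHull_min h ?_) ?_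
    · exact convex_halfSpace_le g.isLinear c
    · exact isClosed_le (LinearMap.continuous_of_finiteDimensional g) continuous_const
  rw [closure_convexHull_extremePoints isCompact_feasibleSet convex_feasibleSet] at h1
  exact absurd (h1 hy) (not_le.2 hc)

/-- Extreme points are rational and their coordinates stay away from the bounds they do not
attain. -/
theorem exists_rat_of_mem_extremePoints (hA : (A.map (Int.cast : ℤ → ℝ)).rank = m)
    {v : Fin n → ℝ} (hv : v ∈ (feasibleSet A b lam).extremePoints ℝ) :
    ∃ q : Fin n → ℚ, (∀ j, v j = q j) ∧
      (A.map (Int.cast : ℤ → ℚ)).mulVec q = (fun i => (b i : ℚ)) ∧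
      (∀ j, 0 ≤ q j ∧ q j ≤ lam) ∧
      (∀ j, 0 < v j → 1 / (maxSubdet A : ℚ) ≤ q j) ∧
      ∀ j, v j < lam → q j ≤ lam - 1 / (maxSubdet A : ℚ) := by
  obtain ⟨d, hd1, hd2, hz⟩ := exists_det_mul_eq_intCast hA hv
  choose z hz using hz
  have hd0 : (0 : ℚ) < d := by exact_mod_cast hd1
  have hd0' : (0 : ℝ) < d := by exact_mod_cast hd1
  have hle : 1 / (maxSubdet A : ℚ) ≤ 1 / d :=
    one_div_le_one_div_of_le hd0 (by exact_mod_cast hd2)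
  have hq : ∀ j, v j = ((z j / d : ℚ) : ℝ) := fun j => by
    push_cast
    rw [← hz j]; field_simp
  have hbd : ∀ j, (0 : ℚ) ≤ z j / d ∧ (z j / d : ℚ) ≤ lam := fun j => by
    have := hv.1.2 j
    rw [hq j] at this
    exact_mod_cast this
  refine ⟨fun j => z j / d, hq, ?_, hbd, fun j hj => ?_, fun j hj => ?_⟩
  · ext i
    have := congrFun hv.1.1 i
    simp only [Matrix.mulVec, dotProduct, Matrix.map_apply, hq] at this ⊢
    exact_mod_cast this
  · refine hle.trans ?_
    have : (0 : ℝ) < z j := by rw [← hz j]; positivity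
    have : (1 : ℚ) ≤ z j := by exact_mod_cast this
    exact div_le_div_of_nonneg_right this hd0.le
  · refine le_trans ?_ (sub_le_sub_left hle _)
    -- A strict inequality between integers leaves a gap of 1, which is a gap of `1/d` after
    -- division.
    have h1 : (z j : ℝ) < d * lam := by rw [← hz j]; gcongr
    have h2 : z j < d * lam := by exact_mod_cast h1
    have h3 : (z j : ℚ) + 1 ≤ d * lam := by exact_mod_cast h2
    rw [le_sub_iff_add_le, ← add_div, div_le_iff₀ hd0]
    linarith

/-- A strictly feasible system has a rational solution in the middle of the box. -/
theorem exists_central_point (hn : 1 ≤ n) (hA : (A.map (Int.cast : ℤ → ℝ)).rank = m)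
    (hs : (strictlyFeasibleSet A b lam).Nonempty) :
    ∃ y : Fin n → ℚ, (A.map (Int.cast : ℤ → ℚ)).mulVec y = (fun i => (b i : ℚ)) ∧
      ∀ j, 1 / (2 * n * maxSubdet A : ℚ) ≤ y j ∧
        y j ≤ lam - 1 / (2 * n * maxSubdet A : ℚ) := by
  obtain ⟨x, hx⟩ := hs
  have hxf : x ∈ feasibleSet A b lam := ⟨hx.1, fun j => ⟨(hx.2 j).1.le, (hx.2 j).2.le⟩⟩
  have h1 : ∀ j, ∃ q : Fin n → ℚ, (A.map (Int.cast : ℤ → ℚ)).mulVec q = (fun i => (b i : ℚ)) ∧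
      (∀ k, 0 ≤ q k ∧ q k ≤ lam) ∧ 1 / (maxSubdet A : ℚ) ≤ q j := by
    intro j
    obtain ⟨v, hv, hc⟩ := exists_extremePoint_lt (LinearMap.proj j) hxf (hx.2 j).1
    obtain ⟨q, -, h2, h3, h4, -⟩ := exists_rat_of_mem_extremePoints hA hv
    exact ⟨q, h2, h3, h4 j hc⟩
  have h2 : ∀ j, ∃ q : Fin n → ℚ, (A.map (Int.cast : ℤ → ℚ)).mulVec q = (fun i => (b i : ℚ)) ∧
      (∀ k, 0 ≤ q k ∧ q k ≤ lam) ∧ q j ≤ lam - 1 / (maxSubdet A : ℚ) := by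
    intro j
    obtain ⟨v, hv, hc⟩ := exists_extremePoint_lt (-LinearMap.proj j) hxf
      (c := -lam) (by simpa using (hx.2 j).2)
    obtain ⟨q, -, h2, h3, -, h4⟩ := exists_rat_of_mem_extremePoints hA hv
    exact ⟨q, h2, h3, h4 j (by simpa using hc)⟩
  choose p hp1 hp2 hp3 using h1
  choose r hr1 hr2 hr3 using h2
  have hn0 : (0 : ℚ) < n := by exact_mod_cast hn
  have hδ : 1 / (2 * n * maxSubdet A : ℚ) = (1 / (2 * n)) * (1 / (maxSubdet A : ℚ)) := by
    rw [one_div_mul_one_div]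
  -- Average of the `2n` solutions. In coordinate `j` the term `p j` alone secures the lower margin
  -- and `r j` the upper one, since the other terms stay within the bounds.
  refine ⟨(1 / (2 * n) : ℚ) • ∑ j, (p j + r j), ?_, fun j => ?_⟩
  · rw [Matrix.mulVec_smul, Matrix.mulVec_sum]
    simp only [Matrix.mulVec_add, hp1, hr1]
    ext i
    simp
    field_simp
    ring
  · have hsum : ∀ g : Fin n → ℚ, (∀ k, 0 ≤ g k) → g j ≤ ∑ k, g k := fun g hg =>
      Finset.single_le_sum (fun k _ => hg k) (Finset.mem_univ j)
    have hl := hsum (fun k => p k j + r k j) fun k => add_nonneg (hp2 k j).1 (hr2 k j).1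
    have hu := hsum (fun k => (lam - p k j) + (lam - r k j)) fun k => by
      linarith [(hp2 k j).2, (hr2 k j).2]
    have he : ∑ k, (((lam : ℚ) - p k j) + (lam - r k j)) = 2 * n * lam - ∑ k, (p k j + r k j) := by
      simp only [Finset.sum_add_distrib, Finset.sum_sub_distrib]
      simp
      ring
    rw [he] at hu
    simp only [Pi.smul_apply, Finset.sum_apply, Pi.add_apply, smul_eq_mul]
    rw [hδ]
    constructor
    · gcongr
      linarith [hp3 j, (hr2 j j).1]
    · have : 1 / (2 * n : ℚ) * (1 / (maxSubdet A : ℚ)) ≤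
          1 / (2 * n) * (2 * n * lam - ∑ k, (p k j + r k j)) := by
        gcongr
        linarith [hr3 j, (hp2 j j).2]
      rw [mul_sub] at this
      have h5 : 1 / (2 * n : ℚ) * (2 * n * lam) = lam := by field_simp
      linarith

end Vertices

end BoundedLP
namespace BoundedLP

/-! ### Orthogonal projection onto the solution space and the relaxation step -/

section Projection

open Matrix

variable {m n : ℕ}

/-- `P` is the orthogonal projection onto the common kernel of the first `i` rows of `A`, and `x`
solves the first `i` equations and is at least as close to every solution of the system as the
origin. -/
structure IsPartialSolution (A : Matrix (Fin m) (Fin n) ℚ) (b : Fin m → ℚ) (i : ℕ)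
    (P : Matrix (Fin n) (Fin n) ℚ) (x : Fin n → ℚ) : Prop where
  symm : Pᵀ = P
  idem : P * P = P
  ann : ∀ k : Fin m, (k : ℕ) < i → P *ᵥ A k = 0
  fix : ∀ w, (∀ k : Fin m, (k : ℕ) < i → A k ⬝ᵥ w = 0) → P *ᵥ w = w
  sol : ∀ k : Fin m, (k : ℕ) < i → A k ⬝ᵥ x = b k
  dist : ∀ y, A *ᵥ y = b → (x - y) ⬝ᵥ (x - y) ≤ y ⬝ᵥ y

theorem isPartialSolution_zero (A : Matrix (Fin m) (Fin n) ℚ) (b : Fin m → ℚ) :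
    IsPartialSolution A b 0 1 0 where
  symm := by simp
  idem := by simp
  ann := fun k hk => absurd hk (Nat.not_lt_zero _)
  fix := fun w _ => by simp
  sol := fun k hk => absurd hk (Nat.not_lt_zero _)
  dist := fun y _ => by simp

theorem dotProduct_mulVec_comm_of_symm {P : Matrix (Fin n) (Fin n) ℚ} (h : Pᵀ = P)
    (u w : Fin n → ℚ) : P *ᵥ u ⬝ᵥ w = u ⬝ᵥ P *ᵥ w := by
  rw [dotProduct_mulVec, ← mulVec_transpose, h]

/-- One Gram–Schmidt step: `v` is the part of row `i` orthogonal to the earlier rows. Subtracting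
`vvᵀ/c` removes this direction from the projection. Moving `x` along `v` keeps the earlier equations
and attains the new one; as an orthogonal projection onto a hyperplane containing all solutions, it
brings `x` no farther from any of them. -/
theorem IsPartialSolution.succ {A : Matrix (Fin m) (Fin n) ℚ} {b : Fin m → ℚ} {i : Fin m}
    {P : Matrix (Fin n) (Fin n) ℚ} {x : Fin n → ℚ} (h : IsPartialSolution A b i P x)
    (hw : ∃ w, A *ᵥ w = Pi.single i 1) {v : Fin n → ℚ} (hv : v = P *ᵥ A i) {c : ℚ}
    (hc : c = v ⬝ᵥ A i) :
    IsPartialSolution A b (i + 1) (P - (1 / c) • vecMulVec v v)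
      (x + ((b i - A i ⬝ᵥ x) / c) • v) := by
  have hPv : P *ᵥ v = v := by rw [hv, mulVec_mulVec, h.idem]
  have hcv : v ⬝ᵥ v = c := by
    have h1 : v ⬝ᵥ v = v ⬝ᵥ P *ᵥ A i := congrArg (v ⬝ᵥ ·) hv
    rw [h1, ← dotProduct_mulVec_comm_of_symm h.symm, hPv, hc]
  -- The vector `w` is orthogonal to the earlier rows, so `P` fixes it and `v ⬝ᵥ w = A i ⬝ᵥ w = 1`;
  -- thus `v` cannot vanish.
  have hc0 : c ≠ 0 := by
    rintro rfl
    rw [dotProduct_self_eq_zero] at hcv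
    obtain ⟨w, hw⟩ := hw
    have h1 : ∀ k, A k ⬝ᵥ w = (Pi.single i 1 : Fin m → ℚ) k := fun k => congrFun hw k
    have h2 : P *ᵥ w = w := h.fix w fun k hk => by
      rw [h1, Pi.single_eq_of_ne]
      rintro rfl
      exact lt_irrefl _ hk
    have h3 := h1 i
    rw [← h2, ← dotProduct_mulVec_comm_of_symm h.symm, ← hv, hcv] at h3
    simp at h3
  have hvA : ∀ k : Fin m, (k : ℕ) < i → v ⬝ᵥ A k = 0 := fun k hk => by
    rw [hv, dotProduct_mulVec_comm_of_symm h.symm, h.ann k hk, dotProduct_zero]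
  have hlt : ∀ k : Fin m, (k : ℕ) < i + 1 → (k : ℕ) < i ∨ k = i := fun k hk => by
    rcases Nat.lt_succ_iff_lt_or_eq.1 hk with h' | h'
    · exact Or.inl h'
    · exact Or.inr (Fin.ext h')
  have hmv : ∀ w, (P - (1 / c) • vecMulVec v v) *ᵥ w = P *ᵥ w - ((v ⬝ᵥ w) / c) • v := fun w => by
    rw [sub_mulVec, smul_mulVec, vecMulVec_mulVec]
    ext; simp; ring
  constructor
  · rw [transpose_sub, transpose_smul, h.symm, transpose_vecMulVec]
  · have h1 : P * vecMulVec v v = vecMulVec v v := by rw [mul_vecMulVec, hPv]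
    have h2 : vecMulVec v v * P = vecMulVec v v := by
      rw [vecMulVec_mul, ← mulVec_transpose, h.symm, hPv]
    have h3 : vecMulVec v v * vecMulVec v v = c • vecMulVec v v := by
      rw [vecMulVec_mul_vecMulVec, hcv]
      ext a b; simp [vecMulVec_apply]; ring
    rw [sub_mul, mul_sub, mul_sub, h.idem, mul_smul_comm, h1, smul_mul_assoc, h2, smul_mul_assoc,
      mul_smul_comm, h3, smul_smul (1 / c) c, one_div_mul_cancel hc0, one_smul]
    abel
  · intro k hk
    rw [hmv]
    rcases hlt k hk with hk | rfl
    · rw [hvA k hk, h.ann k hk]; simp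
    · rw [← hc, ← hv, div_self hc0, one_smul, sub_self]
  · intro w hw
    rw [hmv, h.fix w fun k hk => hw k (hk.trans (Nat.lt_succ_self _))]
    have : v ⬝ᵥ w = 0 := by
      rw [hv, dotProduct_mulVec_comm_of_symm h.symm,
        h.fix w fun k hk => hw k (hk.trans (Nat.lt_succ_self _)), hw i (Nat.lt_succ_self _)]
    simp [this]
  · intro k hk
    rw [dotProduct_add, dotProduct_smul, dotProduct_comm _ v]
    rcases hlt k hk with hk | rfl
    · rw [hvA k hk, h.sol k hk]; simp
    · rw [← hc, smul_eq_mul, div_mul_cancel₀ _ hc0]; ring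
  · intro y hy
    refine le_trans ?_ (h.dist y hy)
    have hy' : ∀ k, A k ⬝ᵥ y = b k := fun k => congrFun hy k
    have hg : P *ᵥ (x - y) = x - y := h.fix _ fun k hk => by
      rw [dotProduct_sub, h.sol k hk, hy', sub_self]
    have h1 : v ⬝ᵥ (x - y) = A i ⬝ᵥ x - b i := by
      rw [hv, dotProduct_mulVec_comm_of_symm h.symm, hg, dotProduct_sub, hy']
    have h2 : 0 ≤ c := by rw [← hcv]; exact dotProduct_self_star_nonneg (R := ℚ) v
    rw [add_sub_right_comm]
    simp only [dotProduct_add, add_dotProduct, dotProduct_smul, smul_dotProduct, smul_eq_mul, hcv,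
      h1, dotProduct_comm (x - y) v]
    -- The change in squared distance is minus the squared residual over `c`.
    have h3 : (b i - A i ⬝ᵥ x) / c * (A i ⬝ᵥ x - b i) +
        (b i - A i ⬝ᵥ x) / c * (A i ⬝ᵥ x - b i + (b i - A i ⬝ᵥ x) / c * c) =
        - ((b i - A i ⬝ᵥ x) ^ 2 / c) := by
      field_simp; ring
    have h4 : 0 ≤ (b i - A i ⬝ᵥ x) ^ 2 / c := by positivity
    linarith

/-- Moving along a projected coordinate direction decreases the distance to a point beyond the
target hyperplane. -/
theorem relaxation_step {P : Matrix (Fin n) (Fin n) ℚ} (hP : Pᵀ = P) (hPP : P * P = P)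
    {x y : Fin n → ℚ} (hg : P *ᵥ (x - y) = x - y) (j : Fin n) {t δ : ℚ} (hne : x j ≠ y j)
    (h1 : (t - x j) * (x j - y j) ≤ - (t - x j) ^ 2) (h2 : δ ^ 2 ≤ (t - x j) ^ 2) :
    (x + ((t - x j) / P j j) • P.col j - y) ⬝ᵥ (x + ((t - x j) / P j j) • P.col j - y) + δ ^ 2 ≤
      (x - y) ⬝ᵥ (x - y) := by
  set e : Fin n → ℚ := Pi.single j 1 with he
  have hcol : P.col j = P *ᵥ e := by rw [he, mulVec_single_one]
  have hgj : P.col j ⬝ᵥ (x - y) = x j - y j := by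
    rw [hcol, dotProduct_mulVec_comm_of_symm hP, hg, he, single_one_dotProduct]; rfl
  have hjj : P.col j ⬝ᵥ P.col j = P j j := by
    rw [hcol, dotProduct_mulVec_comm_of_symm hP, mulVec_mulVec, hPP, ← hcol, he,
      single_one_dotProduct]; rfl
  -- If `P j j = 0`, column `j` of `P` vanishes and all solutions share coordinate `j`, contrary to
  -- `hne`.
  have hp0 : P j j ≠ 0 := by
    intro h0
    rw [h0, dotProduct_self_eq_zero] at hjj
    rw [hjj, zero_dotProduct] at hgj
    exact hne (sub_eq_zero.1 hgj.symm)
  -- `P j j` is the squared length of column `j`, which has `P j j` among its entries; hence `P j j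
  -- ≤ 1`, and dividing by it only enlarges the gain.
  have hsq : P j j * P j j ≤ P j j := by
    conv_rhs => rw [← hjj]
    exact Finset.single_le_sum (f := fun k => P.col j k * P.col j k)
      (fun k _ => mul_self_nonneg _) (Finset.mem_univ j)
  have hpos : 0 < P j j := lt_of_le_of_ne ((mul_self_nonneg _).trans hsq) hp0.symm
  have hle : P j j ≤ 1 := by
    by_contra! h
    nlinarith
  rw [add_sub_right_comm]
  generalize P.col j = v at *
  generalize P j j = p at *
  simp only [dotProduct_add, add_dotProduct, dotProduct_smul, smul_dotProduct, smul_eq_mul, hjj,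
    hgj, dotProduct_comm (x - y) v]
  have h3 : (t - x j) / p * (x j - y j) +
      ((t - x j) / p * (x j - y j + (t - x j) / p * p)) =
      (2 * ((t - x j) * (x j - y j)) + (t - x j) ^ 2) / p := by
    field_simp; ring
  have h4 : (2 * ((t - x j) * (x j - y j)) + (t - x j) ^ 2) / p ≤ - (δ ^ 2) := by
    rw [div_le_iff₀ hpos]
    nlinarith [sq_nonneg δ]
  linarith

end Projection

end BoundedLP
namespace ArithRAM

/-! ### Total correctness with time bounds -/

/-- `p`, started in `s`, halts within `T` operations in a configuration satisfying `Q`. -/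
def Ends (p : Program) (s : State) (T : ℕ) (Q : State → Prop) : Prop :=
  ∃ t s', Run p s t s' ∧ t ≤ T ∧ Q s'

theorem Ends.mono {p : Program} {s : State} {T T' : ℕ} {Q Q' : State → Prop} (h : Ends p s T Q)
    (hQ : ∀ s', Q s' → Q' s') (hT : T ≤ T') : Ends p s T' Q' := by
  obtain ⟨t, s', h1, h2, h3⟩ := h
  exact ⟨t, s', h1, h2.trans hT, hQ s' h3⟩

theorem ends_setIdx {x : ℕ} {e : IdxTerm} {s : State} {Q : State → Prop}
    (h : Q (s.putIdx x (e.eval s))) : Ends (.setIdx x e) s (e.cost + 1) Q :=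
  ⟨_, _, .setIdx s x e, le_rfl, h⟩

theorem ends_setRat {a : ℕ} {i j : IdxTerm} {e : RatTerm} {s : State} {Q : State → Prop}
    (h : Q (s.putRat a (i.eval s) (j.eval s) (e.eval s))) :
    Ends (.setRat a i j e) s (i.cost + j.cost + e.cost + 1) Q :=
  ⟨_, _, .setRat s a i j e, le_rfl, h⟩

theorem ends_seq {p q : Program} {s : State} {T U : ℕ} {Q : State → Prop}
    (h : Ends p s T fun s' => Ends q s' U Q) : Ends (.seq p q) s (T + U) Q := by
  obtain ⟨t, s₁, h1, h2, u, s₂, h3, h4, h5⟩ := h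
  exact ⟨_, _, .seq h1 h3, by omega, h5⟩

theorem ends_branch {c : Test} {p q : Program} {s : State} {T U : ℕ} {Q : State → Prop}
    (h1 : c.Holds s → Ends p s T Q) (h2 : ¬ c.Holds s → Ends q s U Q) :
    Ends (.branch c p q) s (c.cost + max T U + 1) Q := by
  by_cases h : c.Holds s
  · obtain ⟨t, s', h3, h4, h5⟩ := h1 h
    exact ⟨_, _, .branch_true h h3, by omega, h5⟩
  · obtain ⟨t, s', h3, h4, h5⟩ := h2 h
    exact ⟨_, _, .branch_false h h3, by omega, h5⟩

/-- A loop whose invariant `I k` allows at most `k` further rounds. -/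
theorem ends_loop {c : Test} {p : Program} {T : ℕ} {Q : State → Prop} (I : ℕ → State → Prop)
    (hstep : ∀ k s, I k s → c.Holds s → ∃ k', k = k' + 1 ∧ Ends p s T (I k'))
    (hQ : ∀ k s, I k s → ¬ c.Holds s → Q s) (k : ℕ) (s : State) (h : I k s) :
    Ends (.loop c p) s (k * (c.cost + 1 + T) + (c.cost + 1)) Q := by
  induction k generalizing s with
  | zero =>
    by_cases hc : c.Holds s
    · obtain ⟨k', hk, -⟩ := hstep 0 s h hc
      omega
    · exact ⟨_, _, Run.loop_stop hc, by omega, hQ _ _ h hc⟩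
  | succ k ih =>
    by_cases hc : c.Holds s
    · obtain ⟨k', hk, t, s₁, h1, h2, h3⟩ := hstep _ s h hc
      obtain rfl : k = k' := by omega
      obtain ⟨u, s₂, h4, h5, h6⟩ := ih s₁ h3
      refine ⟨_, _, .loop_step hc h1 h4, ?_, h6⟩
      rw [add_mul]
      omega
    · exact ⟨_, _, Run.loop_stop hc, by omega, hQ _ _ h hc⟩

/-- `for x = 0, …, y - 1 do p`, where `x` and `y` are index registers. -/
def forLoop (x y : ℕ) (p : Program) : Program :=
  .seq (.setIdx x (.lit 0))
    (.loop (.idxLt (.var x) (.var y)) (.seq p (.setIdx x (.add (.var x) (.lit 1)))))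

/-- Each round adds 8 to the body: 4 for the test and its control, 4 for the increment. The final 6
pays for the initialisation and the failing test. -/
theorem ends_forLoop {x y : ℕ} {p : Program} {s : State} {N T : ℕ} {Q : State → Prop}
    (I : ℕ → State → Prop) (hxy : x ≠ y) (hN : s.idx y = N) (h0 : I 0 (s.putIdx x 0))
    (hstep : ∀ k s, k < N → s.idx x = k → s.idx y = N → I k s →
      Ends p s T fun s' => s'.idx x = k ∧ s'.idx y = N ∧ I (k + 1) (s'.putIdx x (k + 1)))
    (hQ : ∀ s, I N s → Q s) :
    Ends (forLoop x y p) s (N * (T + 8) + 6) Q := by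
  have h := ends_loop (c := .idxLt (.var x) (.var y))
    (p := .seq p (.setIdx x (.add (.var x) (.lit 1)))) (T := T + 4) (Q := Q)
    (fun k s => ∃ k', k + k' = N ∧ s.idx x = k' ∧ s.idx y = N ∧ I k' s) ?_ ?_ N (s.putIdx x 0)
    ⟨0, by simp, by simp [State.putIdx], by simp [State.putIdx, hxy.symm, hN], h0⟩
  · refine Ends.mono (ends_seq (ends_setIdx h)) (fun _ h => h) ?_
    · simp only [Test.cost, IdxTerm.cost]
      apply le_of_eq
      ring
  · rintro k s ⟨k', hk, hx, hy, hI⟩ hc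
    simp only [Test.Holds, IdxTerm.eval, hx, hy] at hc
    refine ⟨k - 1, by omega, Ends.mono (ends_seq (Ends.mono (hstep k' s hc hx hy hI) ?_ le_rfl))
      (fun _ h => h) le_rfl⟩
    rintro s' ⟨hx', hy', hI'⟩
    refine ends_setIdx ⟨k' + 1, by omega, ?_, ?_, ?_⟩
    · simp [State.putIdx, IdxTerm.eval, hx']
    · simp [State.putIdx, hxy.symm, hy']
    · simpa [IdxTerm.eval, hx'] using hI'
  · rintro k s ⟨k', hk, hx, hy, hI⟩ hc
    simp only [Test.Holds, IdxTerm.eval, hx, hy] at hc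
    obtain rfl : k' = N := by omega
    exact hQ s hI

/-- `s'` agrees with `s` outside the index registers `X` and the arrays `S`. -/
structure Frame (X S : List ℕ) (s s' : State) : Prop where
  idx : ∀ y, y ∉ X → s'.idx y = s.idx y
  arr : ∀ a, a ∉ S → s'.arr a = s.arr a

theorem Frame.refl (X S : List ℕ) (s : State) : Frame X S s s := ⟨fun _ _ => rfl, fun _ _ => rfl⟩

theorem Frame.trans {X S X' S' : List ℕ} {s s' s'' : State} (h : Frame X S s s')
    (h' : Frame X' S' s' s'') (hX : X' ⊆ X) (hS : S' ⊆ S) : Frame X S s s'' :=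
  ⟨fun y hy => (h'.idx y fun h => hy (hX h)).trans (h.idx y hy),
    fun a ha => (h'.arr a fun h => ha (hS h)).trans (h.arr a ha)⟩

theorem Frame.mono {X S X' S' : List ℕ} {s s' : State} (h : Frame X' S' s s') (hX : X' ⊆ X)
    (hS : S' ⊆ S) : Frame X S s s' :=
  (Frame.refl X S s).trans h hX hS

theorem Frame.putIdx {X S : List ℕ} {s s' : State} (h : Frame X S s s') {x : ℕ} (hx : x ∈ X)
    (k : ℕ) : Frame X S s (s'.putIdx x k) :=
  ⟨fun y hy => by
    have : y ≠ x := fun h => hy (h ▸ hx)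
    simp [State.putIdx, this, h.idx y hy], h.arr⟩

theorem Frame.putRat {X S : List ℕ} {s s' : State} (h : Frame X S s s') {a : ℕ} (ha : a ∈ S)
    (i j : ℕ) (q : ℚ) : Frame X S s (s'.putRat a i j q) :=
  ⟨h.idx, fun b hb => by
    have : b ≠ a := fun h => hb (h ▸ ha)
    ext
    simp [State.putRat, this, h.arr b hb]⟩

@[simp] theorem putIdx_arr (s : State) (x k : ℕ) : (s.putIdx x k).arr = s.arr := rfl

@[simp] theorem putRat_idx (s : State) (a i j : ℕ) (q : ℚ) : (s.putRat a i j q).idx = s.idx := rfl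

theorem putIdx_idx (s : State) (x k y : ℕ) :
    (s.putIdx x k).idx y = if y = x then k else s.idx y := rfl

theorem putRat_arr (s : State) (a i j : ℕ) (q : ℚ) (a' i' j' : ℕ) :
    (s.putRat a i j q).arr a' i' j' = if a' = a ∧ i' = i ∧ j' = j then q else s.arr a' i' j' := rfl

end ArithRAM

namespace BoundedLP

open ArithRAM

/-! ### The program

Registers: `2`, `3`, `4` are loop counters, `5` is a flag. Arrays: `3` holds the current point, `4`
the projection matrix, `5` a projected row; the cells `(0, 0)` of the arrays `6`, …, `10` hold the
number `n`, the margin `δ`, the remaining potential, a squared length and a step size. -/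

/-- The cell `(0, 0)`. -/
def scalar (a : ℕ) : RatTerm := .get a (.lit 0) (.lit 0)

/-- The cell `(x, 0)`, for an index register `x`. -/
def entry (a x : ℕ) : RatTerm := .get a (.var x) (.lit 0)

/-- The cell `(x, y)`, for index registers `x`, `y`. -/
def entry₂ (a x y : ℕ) : RatTerm := .get a (.var x) (.var y)

/-- Assignment to the cell `(0, 0)`. -/
def setScalar (a : ℕ) (e : RatTerm) : Program := .setRat a (.lit 0) (.lit 0) e

/-- Assignment to the cell `(x, 0)`. -/
def setEntry (a x : ℕ) (e : RatTerm) : Program := .setRat a (.var x) (.lit 0) e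

/-- Array `5` becomes the projection of row `idx 2` of `A`. -/
def projectRow : Program :=
  forLoop 3 1 (.seq (setEntry 5 3 (.lit 0))
    (forLoop 4 1 (setEntry 5 3 (.add (entry 5 3) (.mul (entry₂ 4 3 4) (entry₂ 0 2 4))))))

/-- The squared length of the projected row and the step onto its hyperplane. -/
def rowScalars : Program :=
  .seq (setScalar 9 (.lit 0)) <| .seq (setScalar 10 (entry 1 2)) <|
  .seq (forLoop 3 1
    (.seq (setScalar 9 (.add (scalar 9) (.mul (entry 5 3) (entry₂ 0 2 3))))
      (setScalar 10 (.sub (scalar 10) (.mul (entry₂ 0 2 3) (entry 3 3))))))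
  (setScalar 10 (.div (scalar 10) (scalar 9)))

/-- Update of the point and of the projection matrix. -/
def updateRow : Program :=
  forLoop 3 1 (.seq (setEntry 3 3 (.add (entry 3 3) (.mul (scalar 10) (entry 5 3))))
    (forLoop 4 1 (.setRat 4 (.var 3) (.var 4)
      (.sub (entry₂ 4 3 4) (.div (.mul (entry 5 3) (entry 5 4)) (scalar 9))))))

/-- Projection of the origin onto the solution space. -/
def projectAll : Program := forLoop 2 0 (.seq projectRow (.seq rowScalars updateRow))

/-- The identity matrix, the margin and the initial potential. -/
def prepare : Program :=
  .seq (forLoop 3 1 (.seq (.setRat 4 (.var 3) (.var 3) (.lit 1))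
    (.seq (setScalar 8 (.add (scalar 8) (.mul (scalar 2) (scalar 2))))
      (setScalar 6 (.add (scalar 6) (.lit 1)))))) <|
  .seq (setScalar 7 (.div (.lit 1) (.mul (.mul (.lit 2) (scalar 6)) (.get 2 (.lit 0) (.lit 1)))))
    (setScalar 8 (.add (scalar 8) (.mul (scalar 2) (scalar 2))))

/-- The step size for the coordinate `idx 3`; the flag is cleared if a bound is violated. -/
def stepSize : Program :=
  .branch (.ratLt (entry 3 3) (.lit 0))
    (.seq (.setIdx 5 (.lit 0))
      (setScalar 10 (.div (.sub (scalar 7) (entry 3 3)) (entry₂ 4 3 3))))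
    (.branch (.ratLt (scalar 2) (entry 3 3))
      (.seq (.setIdx 5 (.lit 0))
        (setScalar 10 (.div (.sub (.sub (scalar 2) (scalar 7)) (entry 3 3)) (entry₂ 4 3 3))))
      (setScalar 10 (.lit 0)))

/-- Motion along the projected coordinate direction `idx 3`. -/
def move : Program :=
  forLoop 4 1 (setEntry 3 4 (.add (entry 3 4) (.mul (scalar 10) (entry₂ 4 4 3))))

/-- One relaxation step for every coordinate. -/
def sweep : Program := .seq (.setIdx 5 (.lit 1)) (forLoop 3 1 (.seq stepSize move))

/-- Sweeps until no bound is violated or the potential is exhausted. -/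
def relax : Program :=
  .loop (.ratLt (.lit 0) (scalar 8)) <| .seq sweep <|
    .branch (.idxEq (.var 5) (.lit 1)) (setScalar 8 (.lit 0))
      (setScalar 8 (.sub (scalar 8) (.mul (scalar 7) (scalar 7))))

/-- Output of the point and of the verdict. -/
def output : Program :=
  .seq (forLoop 4 1 (setEntry 0 4 (entry 3 4))) (.setIdx 0 (.var 5))

/-- The relaxation algorithm for bounded systems. -/
def solver : Program := .seq prepare (.seq projectAll (.seq relax output))

/-! ### Specifications -/

theorem ends_setScalar {a : ℕ} {e : RatTerm} {s : State} {Q : State → Prop}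
    (h : Q (s.putRat a 0 0 (e.eval s))) : Ends (setScalar a e) s (e.cost + 3) Q :=
  (ends_setRat (i := .lit 0) (j := .lit 0) h).mono (fun _ h => h)
    (by simp only [IdxTerm.cost]; omega)

theorem ends_setEntry {a x : ℕ} {e : RatTerm} {s : State} {Q : State → Prop}
    (h : Q (s.putRat a (s.idx x) 0 (e.eval s))) : Ends (setEntry a x e) s (e.cost + 3) Q :=
  (ends_setRat (i := .var x) (j := .lit 0) h).mono (fun _ h => h)
    (by simp only [IdxTerm.cost]; omega)

@[simp] theorem eval_scalar (a : ℕ) (s : State) : (scalar a).eval s = s.arr a 0 0 := rfl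

@[simp] theorem eval_entry (a x : ℕ) (s : State) : (entry a x).eval s = s.arr a (s.idx x) 0 := rfl

@[simp] theorem eval_entry₂ (a x y : ℕ) (s : State) :
    (entry₂ a x y).eval s = s.arr a (s.idx x) (s.idx y) := rfl

theorem projectRow_spec {s : State} {n : ℕ} (hn : s.idx 1 = n) :
    Ends projectRow s (n * (n * 22 + 18) + 6) fun s' => Frame [3, 4] [5] s s' ∧
      ∀ j < n, s'.arr 5 j 0 = ∑ k ∈ Finset.range n, s.arr 4 j k * s.arr 0 (s.idx 2) k := by
  refine (ends_forLoop (T := n * 22 + 10) (fun j s' => Frame [3, 4] [5] s s' ∧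
      ∀ j' < j, s'.arr 5 j' 0 = ∑ k ∈ Finset.range n, s.arr 4 j' k * s.arr 0 (s.idx 2) k)
      (by decide) hn ⟨(Frame.refl _ _ _).putIdx (by simp) _, by simp⟩ ?_ (fun _ h => h)).mono
      (fun _ h => h) (by ring_nf; rfl)
  rintro j s₁ hj h3 h1 ⟨hF, hs⟩
  refine (ends_seq (ends_setEntry (ends_forLoop (N := n) (T := 14)
    (fun k s' => s'.idx 3 = j ∧ Frame [3, 4] [5] s s' ∧
      (∀ j' < j, s'.arr 5 j' 0 = s₁.arr 5 j' 0) ∧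
      s'.arr 5 j 0 = ∑ k ∈ Finset.range k, s.arr 4 j k * s.arr 0 (s.idx 2) k)
    (by decide) (by simpa using h1) ?_ ?_ ?_))).mono (fun _ h => h)
    (by simp [RatTerm.cost]; ring_nf; rfl)
  · refine ⟨by simp [putIdx_idx, h3], (hF.putRat (by simp) _ _ _).putIdx (by simp) _, ?_, ?_⟩
    · intro j' hj'
      simp [putRat_arr, h3, hj'.ne]
    · simp [putRat_arr, h3, RatTerm.eval]
  · rintro k s₂ hk h4 - ⟨h3, hF, hs', hsum⟩
    refine (ends_setEntry ?_).mono (fun _ h => h) (by decide)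
    refine ⟨by simp [h4], by simp [hF.idx 1 (by decide), hn], by simp [putIdx_idx, h3],
      (hF.putRat (by simp) _ _ _).putIdx (by simp) _, ?_, ?_⟩
    · intro j' hj'
      simp [putRat_arr, h3, hj'.ne, hs' j' hj']
    · simp [putRat_arr, h3, RatTerm.eval, hsum, Finset.sum_range_succ, h4,
        hF.arr 4 (by decide), hF.arr 0 (by decide), hF.idx 2 (by decide)]
  · rintro s₂ ⟨h3, hF, hs', hsum⟩
    refine ⟨h3, by simp [hF.idx 1 (by decide), hn], hF.putIdx (by simp) _, ?_⟩
    intro j' hj'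
    rcases Nat.lt_succ_iff_lt_or_eq.1 hj' with h | rfl
    · simp [hs' j' h, hs j' h]
    · simpa using hsum

end BoundedLP
namespace BoundedLP

open ArithRAM

theorem rowScalars_spec {s : State} {n : ℕ} (hn : s.idx 1 = n) :
    Ends rowScalars s (n * 36 + 26) fun s' => Frame [3] [9, 10] s s' ∧
      s'.arr 9 0 0 = ∑ k ∈ Finset.range n, s.arr 5 k 0 * s.arr 0 (s.idx 2) k ∧
      s'.arr 10 0 0 = (s.arr 1 (s.idx 2) 0 -
        ∑ k ∈ Finset.range n, s.arr 0 (s.idx 2) k * s.arr 3 k 0) / s'.arr 9 0 0 := by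
  refine (ends_seq (ends_setScalar (ends_seq (ends_setScalar (ends_seq (U := 10)
    (ends_forLoop (N := n) (T := 28) (fun k s' => Frame [3] [9, 10] s s' ∧
      s'.arr 9 0 0 = ∑ k ∈ Finset.range k, s.arr 5 k 0 * s.arr 0 (s.idx 2) k ∧
      s'.arr 10 0 0 = s.arr 1 (s.idx 2) 0 -
        ∑ k ∈ Finset.range k, s.arr 0 (s.idx 2) k * s.arr 3 k 0)
    (by decide) (by simpa using hn) ?_ ?_ ?_)))))).mono (fun _ h => h) ?_
  · refine ⟨(((Frame.refl _ _ _).putRat (by simp) _ _ _).putRat (by simp) _ _ _).putIdx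
      (by simp) _, ?_, ?_⟩ <;> simp [putRat_arr, RatTerm.eval]
  · rintro k s₁ hk h3 h1 ⟨hF, hs, hs'⟩
    refine (ends_seq (ends_setScalar (ends_setScalar ?_))).mono (fun _ h => h) (by decide)
    refine ⟨by simp [h3], by simp [h1],
      ((hF.putRat (by simp) _ _ _).putRat (by simp) _ _ _).putIdx (by simp) _, ?_, ?_⟩
    · simp [putRat_arr, RatTerm.eval, hs, Finset.sum_range_succ, h3, hF.arr 5 (by decide),
        hF.arr 0 (by decide), hF.idx 2 (by decide)]
    · simp [putRat_arr, RatTerm.eval, hs', Finset.sum_range_succ, h3, hF.arr 3 (by decide),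
        hF.arr 0 (by decide), hF.idx 2 (by decide), sub_sub]
  · rintro s₁ ⟨hF, hs, hs'⟩
    refine (ends_setScalar ?_).mono (fun _ h => h) (by decide)
    refine ⟨hF.putRat (by simp) _ _ _, ?_, ?_⟩ <;> simp [putRat_arr, RatTerm.eval, hs, hs']
  · simp [RatTerm.cost, entry, IdxTerm.cost]; omega

theorem updateRow_spec {s : State} {n : ℕ} (hn : s.idx 1 = n) :
    Ends updateRow s (n * (n * 27 + 28) + 6) fun s' => Frame [3, 4] [3, 4] s s' ∧
      (∀ j < n, s'.arr 3 j 0 = s.arr 3 j 0 + s.arr 10 0 0 * s.arr 5 j 0) ∧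
      ∀ j < n, ∀ k < n, s'.arr 4 j k =
        s.arr 4 j k - s.arr 5 j 0 * s.arr 5 k 0 / s.arr 9 0 0 := by
  -- The update is done in place, so the invariant also records that the rows not yet reached are
  -- unchanged.
  refine (ends_forLoop (T := n * 27 + 20) (fun j s' => Frame [3, 4] [3, 4] s s' ∧
      (∀ i, s'.arr 3 i 0 = if i < j then s.arr 3 i 0 + s.arr 10 0 0 * s.arr 5 i 0
        else s.arr 3 i 0) ∧
      ∀ i, ∀ k < n, s'.arr 4 i k = if i < j then
        s.arr 4 i k - s.arr 5 i 0 * s.arr 5 k 0 / s.arr 9 0 0 else s.arr 4 i k)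
      (by decide) hn ⟨(Frame.refl _ _ _).putIdx (by simp) _, by simp, by simp⟩ ?_ ?_).mono
      (fun _ h => h) (by ring_nf; rfl)
  · rintro j s₁ hj h3 h1 ⟨hF, hx, hP⟩
    -- Matrix cells are processed in lexicographic order.
    refine (ends_seq (ends_setEntry (ends_forLoop (N := n) (T := 19)
      (fun l s' => s'.idx 3 = j ∧ Frame [3, 4] [3, 4] s s' ∧
        (∀ i, s'.arr 3 i 0 = if i < j + 1 then s.arr 3 i 0 + s.arr 10 0 0 * s.arr 5 i 0
          else s.arr 3 i 0) ∧
        ∀ i, ∀ k < n, s'.arr 4 i k = if i < j ∨ i = j ∧ k < l then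
          s.arr 4 i k - s.arr 5 i 0 * s.arr 5 k 0 / s.arr 9 0 0 else s.arr 4 i k)
      (by decide) (by simpa using h1) ?_ ?_ ?_))).mono (fun _ h => h)
      (by simp [RatTerm.cost, scalar, entry, IdxTerm.cost]; ring_nf; rfl)
    · refine ⟨by simp [putIdx_idx, h3], (hF.putRat (by simp) _ _ _).putIdx (by simp) _, ?_, ?_⟩
      · intro i
        simp only [putIdx_arr, putRat_arr, h3, RatTerm.eval, eval_entry, eval_scalar, hx,
          hF.arr 10 (by decide), hF.arr 5 (by decide)]
        by_cases hi : i = j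
        · simp [hi]
        · have : i < j + 1 ↔ i < j := by omega
          simp [hi, this]
      · intro i k hk
        simp [putRat_arr, hP i k hk]
    · rintro l s₂ hl h4 - ⟨h3, hF, hx, hP⟩
      refine (ends_setRat ?_).mono (fun _ h => h) (by decide)
      refine ⟨by simp [h4], by simp [hF.idx 1 (by decide), hn], by simp [putIdx_idx, h3],
        (hF.putRat (by simp) _ _ _).putIdx (by simp) _, ?_, ?_⟩
      · intro i
        simp [putRat_arr, hx]
      · intro i k hk
        simp only [putIdx_arr, putRat_arr, IdxTerm.eval, h3, h4, RatTerm.eval, eval_entry,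
          eval_entry₂, eval_scalar, hP j l hl, hP i k hk, hF.arr 5 (by decide),
          hF.arr 9 (by decide)]
        by_cases hi : i = j ∧ k = l
        · obtain ⟨rfl, rfl⟩ := hi
          simp
        · have : (i < j ∨ i = j ∧ k < l + 1) ↔ (i < j ∨ i = j ∧ k < l) := by omega
          simp only [true_and, hi, this, if_false]
    · rintro s₂ ⟨h3, hF, hx, hP⟩
      refine ⟨h3, by simp [hF.idx 1 (by decide), hn], hF.putIdx (by simp) _, hx, ?_⟩
      intro i k hk
      have : (i < j ∨ i = j ∧ k < n) ↔ i < j + 1 := by omega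
      simp [hP i k hk, this]
  · rintro s₁ ⟨hF, hx, hP⟩
    exact ⟨hF, fun j hj => by simp [hx, hj], fun j hj k hk => by simp [hP j k hk, hj]⟩

theorem stepSize_spec (s : State) :
    Ends stepSize s 40 fun s' => Frame [5] [10] s s' ∧
      (0 ≤ s.arr 3 (s.idx 3) 0 → s.arr 3 (s.idx 3) 0 ≤ s.arr 2 0 0 →
        s'.idx 5 = s.idx 5 ∧ s'.arr 10 0 0 = 0) ∧
      (s.arr 3 (s.idx 3) 0 < 0 → s'.idx 5 = 0 ∧ s'.arr 10 0 0 =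
        (s.arr 7 0 0 - s.arr 3 (s.idx 3) 0) / s.arr 4 (s.idx 3) (s.idx 3)) ∧
      (0 ≤ s.arr 3 (s.idx 3) 0 → s.arr 2 0 0 < s.arr 3 (s.idx 3) 0 →
        s'.idx 5 = 0 ∧ s'.arr 10 0 0 =
        (s.arr 2 0 0 - s.arr 7 0 0 - s.arr 3 (s.idx 3) 0) / s.arr 4 (s.idx 3) (s.idx 3)) := by
  refine (ends_branch (fun h => ends_seq (ends_setIdx (ends_setScalar ?_)))
    (fun h => ends_branch (fun h' => ends_seq (ends_setIdx (ends_setScalar ?_)))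
      (fun h' => ends_setScalar ?_))).mono (fun _ h => h) (by decide)
  · simp only [Test.Holds, eval_entry, RatTerm.eval] at h
    refine ⟨((Frame.refl _ _ _).putIdx (by simp) _).putRat (by simp) _ _ _, ?_, ?_, ?_⟩
    · intro h'; linarith
    · intro _
      simp [putRat_arr, putIdx_idx, RatTerm.eval, IdxTerm.eval]
    · intro h'; linarith
  · simp only [Test.Holds, eval_entry, eval_scalar, RatTerm.eval] at h h'
    refine ⟨((Frame.refl _ _ _).putIdx (by simp) _).putRat (by simp) _ _ _, ?_, ?_, ?_⟩
    · intro _ _; linarith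
    · intro _; linarith
    · intro _ _
      simp [putRat_arr, putIdx_idx, RatTerm.eval, IdxTerm.eval]
  · simp only [Test.Holds, eval_entry, eval_scalar, RatTerm.eval] at h h'
    refine ⟨(Frame.refl _ _ _).putRat (by simp) _ _ _, ?_, ?_, ?_⟩
    · intro _ _
      simp [putRat_arr, RatTerm.eval]
    · intro _; linarith
    · intro _ _; linarith

theorem move_spec {s : State} {n : ℕ} (hn : s.idx 1 = n) :
    Ends move s (n * 22 + 6) fun s' => Frame [4] [3] s s' ∧
      ∀ k < n, s'.arr 3 k 0 = s.arr 3 k 0 + s.arr 10 0 0 * s.arr 4 k (s.idx 3) := by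
  refine ends_forLoop (T := 14) (fun j s' => Frame [4] [3] s s' ∧
      ∀ i, s'.arr 3 i 0 = if i < j then s.arr 3 i 0 + s.arr 10 0 0 * s.arr 4 i (s.idx 3)
        else s.arr 3 i 0)
      (by decide) hn ⟨(Frame.refl _ _ _).putIdx (by simp) _, by simp⟩ ?_ ?_
  · rintro j s₁ hj h4 h1 ⟨hF, hx⟩
    refine (ends_setEntry ?_).mono (fun _ h => h) (by decide)
    refine ⟨by simp [h4], by simp [h1], (hF.putRat (by simp) _ _ _).putIdx (by simp) _, ?_⟩
    intro i
    simp only [putIdx_arr, putRat_arr, h4, RatTerm.eval, eval_entry, eval_entry₂, eval_scalar, hx,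
      hF.arr 10 (by decide), hF.arr 4 (by decide), hF.idx 3 (by decide)]
    by_cases hi : i = j
    · simp [hi]
    · have : i < j + 1 ↔ i < j := by omega
      simp [hi, this]
  · rintro s₁ ⟨hF, hx⟩
    exact ⟨hF, fun k hk => by simp [hx, hk]⟩

theorem output_spec {s : State} {n : ℕ} (hn : s.idx 1 = n) :
    Ends output s (n * 18 + 8) fun s' => s'.idx 0 = s.idx 5 ∧
      ∀ k < n, s'.arr 0 k 0 = s.arr 3 k 0 := by
  refine (ends_seq (U := 2) (ends_forLoop (T := 10) (fun j s' => Frame [4] [0] s s' ∧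
      ∀ i < j, s'.arr 0 i 0 = s.arr 3 i 0)
      (by decide) hn ⟨(Frame.refl _ _ _).putIdx (by simp) _, by simp⟩ ?_ ?_)).mono
      (fun _ h => h) ?_
  · rintro j s₁ hj h4 h1 ⟨hF, hx⟩
    refine (ends_setEntry ?_).mono (fun _ h => h) (by decide)
    refine ⟨by simp [h4], by simp [h1], (hF.putRat (by simp) _ _ _).putIdx (by simp) _, ?_⟩
    intro i hi
    simp only [putIdx_arr, putRat_arr, h4, eval_entry, hF.arr 3 (by decide)]
    rcases Nat.lt_succ_iff_lt_or_eq.1 hi with h | rfl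
    · simp [h.ne, hx i h]
    · simp
  · rintro s₁ ⟨hF, hx⟩
    refine (ends_setIdx ?_).mono (fun _ h => h) (by decide)
    exact ⟨by simp [putIdx_idx, IdxTerm.eval, hF.idx 5 (by decide)], hx⟩
  · omega

theorem prepare_spec {m n : ℕ} (A : Matrix (Fin m) (Fin n) ℤ) (b : Fin m → ℤ) (lam Δ : ℕ) :
    Ends prepare (inputState A b lam Δ) (n * 40 + 40) fun s' =>
      Frame [3] [4, 6, 7, 8] (inputState A b lam Δ) s' ∧
      (∀ j k : ℕ, s'.arr 4 j k = if j = k ∧ j < n then 1 else 0) ∧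
      s'.arr 7 0 0 = 1 / (2 * n * Δ) ∧ s'.arr 8 0 0 = n * lam ^ 2 + lam ^ 2 := by
  set s := inputState A b lam Δ with hs
  have h2 : s.arr 2 0 0 = lam := by simp [hs, inputState]
  have h2' : s.arr 2 0 1 = Δ := by simp [hs, inputState]
  refine (ends_seq (U := 34) (ends_forLoop (N := n) (T := 32) (fun l s' => Frame [3] [4, 6, 7, 8] s s' ∧
      (∀ j k : ℕ, s'.arr 4 j k = if j = k ∧ j < l then 1 else 0) ∧
      s'.arr 6 0 0 = l ∧ s'.arr 8 0 0 = l * lam ^ 2)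
      (by decide) (by simp [hs, inputState]) ?_ ?_ ?_)).mono (fun _ h => h) ?_
  · refine ⟨(Frame.refl _ _ _).putIdx (by simp) _, ?_, ?_, ?_⟩ <;> simp [hs, inputState]
  · rintro l s₁ hl h3 h1 ⟨hF, hP, h6, h8⟩
    refine (ends_seq (ends_setRat (ends_seq (ends_setScalar (ends_setScalar ?_))))).mono
      (fun _ h => h) (by decide)
    refine ⟨by simp [h3], by simp [h1], (((hF.putRat (by simp) _ _ _).putRat (by simp) _ _ _).putRat
      (by simp) _ _ _).putIdx (by simp) _, ?_, ?_, ?_⟩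
    · intro j k
      simp only [putIdx_arr, putRat_arr, IdxTerm.eval, h3, RatTerm.eval, hP]
      by_cases hj : j = l ∧ k = l
      · obtain ⟨rfl, rfl⟩ := hj
        simp
      · have : (j = k ∧ j < l + 1) ↔ (j = k ∧ j < l) := by omega
        simp only [true_and, hj, this, if_false]
        simp
    · simp [putRat_arr, RatTerm.eval, h6]
    · simp [putRat_arr, RatTerm.eval, h8, hF.arr 2 (by decide), h2]
      ring
  · rintro s₁ ⟨hF, hP, h6, h8⟩
    refine (ends_seq (ends_setScalar (ends_setScalar ?_))).mono (fun _ h => h) (by decide)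
    refine ⟨(hF.putRat (by simp) _ _ _).putRat (by simp) _ _ _, ?_, ?_, ?_⟩
    · intro j k
      simp [putRat_arr, hP]
    · simp [putRat_arr, RatTerm.eval, IdxTerm.eval, h6, hF.arr 2 (by decide), h2']
    · simp [putRat_arr, RatTerm.eval, h8, hF.arr 2 (by decide), h2]
      ring
  · omega

end BoundedLP
-- Correctness of the projection phase and of the relaxation phase
namespace BoundedLP

open ArithRAM Matrix

/-- Column `0` of array `3` holds the vector `x`. -/
def HasVec {n : ℕ} (s : State) (x : Fin n → ℚ) : Prop := ∀ j : Fin n, s.arr 3 j 0 = x j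

/-- Array `4` holds the matrix `P`. -/
def HasMat {n : ℕ} (s : State) (P : Matrix (Fin n) (Fin n) ℚ) : Prop :=
  ∀ j k : Fin n, s.arr 4 j k = P j k

variable {m n : ℕ} {A : Matrix (Fin m) (Fin n) ℚ} {b : Fin m → ℚ}

/-- Each of the `m` rounds performs the update of `IsPartialSolution.succ` in `O(n²)` operations,
which accounts for the term `n²m`. -/
theorem projectAll_spec (hA : ∀ i, ∃ w, A *ᵥ w = Pi.single i 1) {s : State} (h0 : s.idx 0 = m)
    (h1 : s.idx 1 = n) (hsA : ∀ (i : Fin m) (j : Fin n), s.arr 0 i j = A i j)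
    (hsb : ∀ i : Fin m, s.arr 1 i 0 = b i) (hx : HasVec s (0 : Fin n → ℚ))
    (hP : HasMat s (1 : Matrix (Fin n) (Fin n) ℚ)) :
    Ends projectAll s (m * (n * (n * 49 + 82) + 46) + 6) fun s' =>
      Frame [2, 3, 4] [3, 4, 5, 9, 10] s s' ∧
      ∃ P x, HasMat s' P ∧ HasVec s' x ∧ IsPartialSolution A b m P x := by
  refine (ends_forLoop (N := m) (T := n * (n * 49 + 82) + 38) (fun i s' =>
      Frame [2, 3, 4] [3, 4, 5, 9, 10] s s' ∧
      ∃ P x, HasMat s' P ∧ HasVec s' x ∧ IsPartialSolution A b i P x)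
      (by decide) h0 ⟨(Frame.refl _ _ _).putIdx (by simp) _, 1, 0, hP, hx,
        isPartialSolution_zero A b⟩ ?_ (fun _ h => h)).mono (fun _ h => h) (by ring_nf; rfl)
  rintro i s₀ hi hs2 hs0 ⟨hF, P, x, hP, hx, hS⟩
  have hs1 : s₀.idx 1 = n := (hF.idx 1 (by decide)).trans h1
  have hsA' : ∀ j : Fin n, s₀.arr 0 i j = A ⟨i, hi⟩ j := fun j => by
    rw [hF.arr 0 (by decide)]; exact hsA ⟨i, hi⟩ j
  have hsb' : s₀.arr 1 i 0 = b ⟨i, hi⟩ := by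
    rw [hF.arr 1 (by decide)]; exact hsb ⟨i, hi⟩
  refine (ends_seq (U := n * (n * 27 + 64) + 32) ((projectRow_spec hs1).mono ?_ le_rfl)).mono
    (fun _ h => h) (by ring_nf; rfl)
  rintro s₁ ⟨hF₁, hv⟩
  refine (ends_seq (U := n * (n * 27 + 28) + 6)
    ((rowScalars_spec ((hF₁.idx 1 (by decide)).trans hs1)).mono ?_ le_rfl)).mono
    (fun _ h => h) (by ring_nf; rfl)
  rintro s₂ ⟨hF₂, hc, hr⟩
  refine (updateRow_spec (((hF₂.idx 1 (by decide)).trans (hF₁.idx 1 (by decide))).trans hs1)).mono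
    ?_ le_rfl
  rintro s₃ ⟨hF₃, hx', hP'⟩
  have hv' : ∀ j : Fin n, s₁.arr 5 j 0 = (P *ᵥ A ⟨i, hi⟩) j := fun j => by
    rw [hv j j.2, Finset.sum_range]
    exact Finset.sum_congr rfl fun k _ => by rw [hs2, hP j k, hsA' k]
  have hc' : s₂.arr 9 0 0 = (P *ᵥ A ⟨i, hi⟩) ⬝ᵥ A ⟨i, hi⟩ := by
    rw [hc, Finset.sum_range]
    exact Finset.sum_congr rfl fun k _ => by
      rw [hF₁.idx 2 (by decide), hs2, hv' k, hF₁.arr 0 (by decide), hsA' k]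
  have hr' : s₂.arr 10 0 0 = (b ⟨i, hi⟩ - A ⟨i, hi⟩ ⬝ᵥ x) / s₂.arr 9 0 0 := by
    rw [hr, Finset.sum_range]
    congr 2
    · rw [hF₁.idx 2 (by decide), hs2, hF₁.arr 1 (by decide), hsb']
    · exact Finset.sum_congr rfl fun k _ => by
        rw [hF₁.idx 2 (by decide), hs2, hF₁.arr 0 (by decide), hsA' k, hF₁.arr 3 (by decide), hx k]
  have hF' : Frame [2, 3, 4] [3, 4, 5, 9, 10] s₀ s₃ :=
    ((hF₁.mono (by simp) (by simp)).trans hF₂ (by simp) (by simp)).trans hF₃ (by simp) (by simp)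
  -- Sharper than `hF'`: the body must not touch register 2, the counter of the outer loop.
  have hF'' : Frame [3, 4] [3, 4, 5, 9, 10] s₀ s₃ :=
    ((hF₁.mono (by simp) (by simp)).trans hF₂ (by simp) (by simp)).trans hF₃ (by simp) (by simp)
  refine ⟨(hF''.idx 2 (by decide)).trans hs2, (hF''.idx 0 (by decide)).trans hs0,
    (hF.trans hF' (by simp) (by simp)).putIdx (by simp) _, _, _, ?_, ?_,
    hS.succ (i := ⟨i, hi⟩) (hA _) rfl hc'⟩
  · intro j k
    rw [putIdx_arr, hP' j j.2 k k.2, hF₂.arr 4 (by decide), hF₁.arr 4 (by decide), hP j k,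
      hF₂.arr 5 (by decide), hv' j, hv' k]
    simp [vecMulVec_apply]
    ring
  · intro j
    rw [putIdx_arr, hx' j j.2, hF₂.arr 3 (by decide), hF₁.arr 3 (by decide), hx j,
      hF₂.arr 5 (by decide), hv' j, hr']
    simp

/-- The solutions at distance at least `δ` from all bounds. -/
def IsCentral (A : Matrix (Fin m) (Fin n) ℚ) (b : Fin m → ℚ) (lam δ : ℚ) (y : Fin n → ℚ) : Prop :=
  A *ᵥ y = b ∧ ∀ j, δ ≤ y j ∧ y j ≤ lam - δ

variable {P : Matrix (Fin n) (Fin n) ℚ} {x₀ : Fin n → ℚ} {lam δ : ℚ}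

/-- The columns of `P` lie in `ker A`, because `P` is symmetric and annihilates the rows of `A`. -/
theorem IsPartialSolution.mulVec_add_col (h : IsPartialSolution A b m P x₀) {x : Fin n → ℚ}
    (hx : A *ᵥ x = b) (r : ℚ) (j : Fin n) : A *ᵥ (x + r • P.col j) = b := by
  have : A *ᵥ P.col j = 0 := by
    ext i
    have h1 : P.col j = P *ᵥ Pi.single j 1 := by rw [mulVec_single_one]
    change A i ⬝ᵥ P.col j = 0
    rw [h1, ← dotProduct_mulVec_comm_of_symm h.symm, h.ann i i.2, zero_dotProduct]
  rw [mulVec_add, mulVec_smul, this, smul_zero, add_zero, hx]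

/-- The target `δ` or `lam - δ` lies weakly between `x j` and `y j`, and more than `δ` away from `x
j`, as `relaxation_step` requires. If `P j j = 0`, a violated bound excludes central points, so the
value of the division by zero is immaterial. -/
theorem IsPartialSolution.relaxation (h : IsPartialSolution A b m P x₀) (hδ : 0 < δ)
    {x y : Fin n → ℚ} (hx : A *ᵥ x = b) (hy : IsCentral A b lam δ y) {j : Fin n} {r : ℚ}
    (hr : x j < 0 ∧ r = (δ - x j) / P j j ∨ lam < x j ∧ r = (lam - δ - x j) / P j j) :
    (x + r • P.col j - y) ⬝ᵥ (x + r • P.col j - y) + δ ^ 2 ≤ (x - y) ⬝ᵥ (x - y) := by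
  have hg : P *ᵥ (x - y) = x - y := h.fix _ fun k _ => by
    rw [dotProduct_sub, sub_eq_zero]
    exact (congrFun hx k).trans (congrFun hy.1 k).symm
  have hyj := hy.2 j
  rcases hr with ⟨h1, rfl⟩ | ⟨h1, rfl⟩
  · refine relaxation_step h.symm h.idem hg j (by linarith) ?_ ?_ <;> nlinarith
  · refine relaxation_step h.symm h.idem hg j (by linarith) ?_ ?_ <;> nlinarith

theorem sweep_spec (h : IsPartialSolution A b m P x₀) (hδ : 0 < δ) {s : State}
    (h1 : s.idx 1 = n) (h2 : s.arr 2 0 0 = lam) (h7 : s.arr 7 0 0 = δ) (hP : HasMat s P)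
    {x : Fin n → ℚ} (hx : HasVec s x) (hAx : A *ᵥ x = b) :
    Ends sweep s (n * (n * 22 + 54) + 8) fun s' => Frame [3, 4, 5] [3, 10] s s' ∧
      ∃ x' : Fin n → ℚ, HasVec s' x' ∧ A *ᵥ x' = b ∧
        (s'.idx 5 = 1 ∧ (∀ j, 0 ≤ x' j ∧ x' j ≤ lam) ∨ s'.idx 5 = 0 ∧ ∀ y, IsCentral A b lam δ y →
          (x' - y) ⬝ᵥ (x' - y) + δ ^ 2 ≤ (x - y) ⬝ᵥ (x - y)) := by
  -- As long as the flag is 1 the point has not moved. This is needed because a correction may spoil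
  -- coordinates checked earlier.
  refine (ends_seq (ends_setIdx (ends_forLoop (N := n) (T := n * 22 + 46) (fun j s' =>
      Frame [3, 4, 5] [3, 10] s s' ∧ ∃ x' : Fin n → ℚ, HasVec s' x' ∧ A *ᵥ x' = b ∧
        (s'.idx 5 = 1 ∧ x' = x ∧ (∀ i : Fin n, (i : ℕ) < j → 0 ≤ x' i ∧ x' i ≤ lam) ∨
          s'.idx 5 = 0 ∧ ∀ y, IsCentral A b lam δ y →
          (x' - y) ⬝ᵥ (x' - y) + δ ^ 2 ≤ (x - y) ⬝ᵥ (x - y)))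
    (by decide) (by simpa [putIdx_idx] using h1) ?_ ?_ ?_))).mono (fun _ h => h)
    (by simp only [IdxTerm.cost]; ring_nf; rfl)
  · exact ⟨((Frame.refl _ _ _).putIdx (by simp) _).putIdx (by simp) _, x, hx, hAx,
      Or.inl ⟨rfl, rfl, fun i hi => absurd hi (Nat.not_lt_zero _)⟩⟩
  · rintro j s₁ hj hs3 hs1 ⟨hF, x', hx', hAx', hflag⟩
    refine (ends_seq (U := n * 22 + 6) ((stepSize_spec s₁).mono ?_ le_rfl)).mono (fun _ h => h)
      (by ring_nf; rfl)
    rintro s₂ ⟨hF₂, hin, hlo, hhi⟩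
    refine (move_spec ((hF₂.idx 1 (by decide)).trans hs1)).mono ?_ le_rfl
    rintro s₃ ⟨hF₃, hmove⟩
    have hF₁₃ : Frame [4, 5] [3, 10] s₁ s₃ :=
      (hF₂.mono (by simp) (by simp)).trans hF₃ (by simp) (by simp)
    set J : Fin n := ⟨j, hj⟩ with hJ
    have hP₁ : ∀ k l : Fin n, s₁.arr 4 k l = P k l := fun k l => by
      rw [hF.arr 4 (by decide)]; exact hP k l
    have hjj : s₁.arr 4 (s₁.idx 3) (s₁.idx 3) = P J J := by rw [hs3]; exact hP₁ J J
    have hxj : s₁.arr 3 (s₁.idx 3) 0 = x' J := by rw [hs3]; exact hx' J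
    rw [hxj, hF.arr 2 (by decide), h2] at hin hhi
    rw [hxj] at hlo
    rw [hjj, hF.arr 7 (by decide), h7] at hlo hhi
    have hvec : HasVec s₃ (x' + s₂.arr 10 0 0 • P.col J) := fun k => by
      rw [hmove k k.2, hF₂.arr 3 (by decide), hx' k, hF₂.arr 4 (by decide), hF₂.idx 3 (by decide),
        hs3]
      change _ + _ * s₁.arr 4 k J = _
      rw [hP₁ k J]
      rfl
    refine ⟨(hF₁₃.idx 3 (by decide)).trans hs3, (hF₁₃.idx 1 (by decide)).trans hs1,
      (hF.trans hF₁₃ (by simp) (by simp)).putIdx (by simp) _, _, hvec, h.mulVec_add_col hAx' _ _, ?_⟩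
    have h5 : (s₃.putIdx 3 (j + 1)).idx 5 = s₂.idx 5 := by
      rw [putIdx_idx, if_neg (by decide), hF₃.idx 5 (by decide)]
    rw [h5]
    by_cases hbox : 0 ≤ x' J ∧ x' J ≤ lam
    · obtain ⟨h5', h10⟩ := hin hbox.1 hbox.2
      rw [h5', h10, zero_smul, add_zero]
      refine hflag.imp (fun ⟨hf, hxx, hb⟩ => ⟨hf, hxx, fun i hi => ?_⟩) id
      rcases Nat.lt_succ_iff_lt_or_eq.1 hi with h' | h'
      · exact hb i h'
      · obtain rfl : i = J := Fin.ext h'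
        exact hbox
    · have hr : s₂.idx 5 = 0 ∧ (x' J < 0 ∧ s₂.arr 10 0 0 = (δ - x' J) / P J J ∨
          lam < x' J ∧ s₂.arr 10 0 0 = (lam - δ - x' J) / P J J) := by
        by_cases h0 : x' J < 0
        · exact ⟨(hlo h0).1, Or.inl ⟨h0, (hlo h0).2⟩⟩
        · have h0' : lam < x' J := by
            by_contra h'
            exact hbox ⟨not_lt.1 h0, not_lt.1 h'⟩
          exact ⟨(hhi (not_lt.1 h0) h0').1, Or.inr ⟨h0', (hhi (not_lt.1 h0) h0').2⟩⟩
      refine Or.inr ⟨hr.1, fun y hy => ?_⟩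
      have hstep := h.relaxation hδ hAx' hy hr.2
      -- The first correction gains `δ²`; the gains of later ones are discarded, so a sweep is
      -- credited with a single `δ²`.
      rcases hflag with ⟨-, rfl, -⟩ | ⟨-, hD⟩
      · exact hstep
      · linarith [hD y hy, sq_nonneg δ]
  · rintro s₁ ⟨hF, x', hx', hAx', hflag⟩
    exact ⟨hF, x', hx', hAx', hflag.imp (fun ⟨hf, _, hb⟩ => ⟨hf, fun j => hb j j.2⟩) id⟩

/-- Cell `(0, 0)` of array 8 is a potential dominating the squared distance to every central point
plus `ε`. An unsuccessful sweep lowers both sides by `δ²`. Since `ε > 0`, a potential that is no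
longer positive excludes central points. -/
theorem relax_spec (h : IsPartialSolution A b m P x₀) (hδ : 0 < δ) {s : State}
    (h1 : s.idx 1 = n) (h2 : s.arr 2 0 0 = lam) (h5 : s.idx 5 = 0) (h7 : s.arr 7 0 0 = δ)
    (hP : HasMat s P) {x : Fin n → ℚ} (hx : HasVec s x) (hAx : A *ᵥ x = b) {ε : ℚ} (hε : 0 < ε)
    (hD : ∀ y, IsCentral A b lam δ y → (x - y) ⬝ᵥ (x - y) + ε ≤ s.arr 8 0 0) {K : ℕ}
    (hK : s.arr 8 0 0 ≤ K * δ ^ 2) :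
    Ends relax s (K * (n * (n * 22 + 54) + 35) + 6) fun s' => s'.idx 1 = n ∧
      ∃ x' : Fin n → ℚ, HasVec s' x' ∧ A *ᵥ x' = b ∧
        (s'.idx 5 = 1 ∧ (∀ j, 0 ≤ x' j ∧ x' j ≤ lam) ∨
          s'.idx 5 = 0 ∧ ∀ y, ¬ IsCentral A b lam δ y) := by
  refine (ends_loop (T := n * (n * 22 + 54) + 8 + 21) (fun k s' =>
      Frame [3, 4, 5] [3, 8, 10] s s' ∧ s'.arr 8 0 0 ≤ k * δ ^ 2 ∧
      ∃ x' : Fin n → ℚ, HasVec s' x' ∧ A *ᵥ x' = b ∧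
        (s'.idx 5 = 1 ∧ (∀ j, 0 ≤ x' j ∧ x' j ≤ lam) ∧ s'.arr 8 0 0 = 0 ∨
          s'.idx 5 = 0 ∧ ∀ y, IsCentral A b lam δ y →
            (x' - y) ⬝ᵥ (x' - y) + ε ≤ s'.arr 8 0 0)) ?_ ?_ K s
      ⟨Frame.refl _ _ _, hK, x, hx, hAx, Or.inr ⟨h5, hD⟩⟩).mono (fun _ h => h) ?_
  · rintro k s₁ ⟨hF, hk, x₁, hx₁, hAx₁, hflag⟩ hc
    simp only [Test.Holds, RatTerm.eval, eval_scalar] at hc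
    -- With no rounds left the potential is at most 0 and the loop test fails.
    obtain ⟨k, rfl⟩ : ∃ k', k = k' + 1 := by
      refine Nat.exists_eq_succ_of_ne_zero ?_
      rintro rfl
      simp at hk
      linarith
    refine ⟨k, rfl, ends_seq ((sweep_spec h hδ ((hF.idx 1 (by decide)).trans h1)
      (by rw [hF.arr 2 (by decide), h2]) (by rw [hF.arr 7 (by decide), h7])
      (fun i j => by rw [hF.arr 4 (by decide)]; exact hP i j) hx₁ hAx₁).mono ?_ le_rfl)⟩
    rintro s₂ ⟨hF₂, x₂, hx₂, hAx₂, hflag₂⟩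
    have hF' : Frame [3, 4, 5] [3, 8, 10] s s₂ := hF.trans hF₂ (by simp) (by simp)
    refine (ends_branch (fun hc₂ => ends_setScalar ?_) (fun hc₂ => ends_setScalar ?_)).mono
      (fun _ h => h) (by decide)
    · simp only [Test.Holds, IdxTerm.eval] at hc₂
      refine ⟨hF'.putRat (by simp) _ _ _, ?_, x₂, ?_, hAx₂, Or.inl ⟨hc₂, ?_, ?_⟩⟩
      · simp only [putRat_arr, RatTerm.eval, and_self, if_true]
        positivity
      · intro j
        simp only [putRat_arr]
        exact hx₂ j
      · rcases hflag₂ with ⟨-, h'⟩ | ⟨h', -⟩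
        · exact h'
        · omega
      · simp [putRat_arr, RatTerm.eval]
    · simp only [Test.Holds, IdxTerm.eval] at hc₂
      have h8 : (s₂.putRat 8 0 0 (((scalar 8).sub ((scalar 7).mul (scalar 7))).eval s₂)).arr 8 0 0 =
          s₁.arr 8 0 0 - δ ^ 2 := by
        simp only [putRat_arr, RatTerm.eval, eval_scalar, and_self, if_true,
          hF₂.arr 8 (by decide), hF'.arr 7 (by decide), h7]
        ring
      refine ⟨hF'.putRat (by simp) _ _ _, ?_, x₂, ?_, hAx₂, Or.inr ⟨?_, ?_⟩⟩
      · rw [h8]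
        push_cast at hk
        linarith
      · intro j
        simp only [putRat_arr]
        exact hx₂ j
      · rcases hflag₂ with ⟨h', -⟩ | ⟨h', -⟩
        · exact absurd h' hc₂
        · exact h'
      · intro y hy
        rw [h8]
        rcases hflag₂ with ⟨h', -⟩ | ⟨-, h'⟩
        · exact absurd h' hc₂
        -- After a success the potential is 0, so the loop could not have been entered again.
        · rcases hflag with ⟨-, -, h0⟩ | ⟨-, hD'⟩
          · linarith
          · linarith [h' y hy, hD' y hy]
  · rintro k s₁ ⟨hF, hk, x₁, hx₁, hAx₁, hflag⟩ hc
    simp only [Test.Holds, RatTerm.eval, eval_scalar] at hc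
    refine ⟨(hF.idx 1 (by decide)).trans h1, x₁, hx₁, hAx₁,
      hflag.imp (fun ⟨a, b, _⟩ => ⟨a, b⟩) fun ⟨a, hy⟩ => ⟨a, fun y hy' => hc ?_⟩⟩
    have h0 : 0 ≤ (x₁ - y) ⬝ᵥ (x₁ - y) := dotProduct_self_star_nonneg (R := ℚ) (x₁ - y)
    linarith [hy y hy']
  · simp only [Test.cost, RatTerm.cost, scalar, IdxTerm.cost]
    apply le_of_eq
    ring

end BoundedLP
-- Correctness of the solver and comparison with the time bound
namespace BoundedLP

open ArithRAM Matrix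

/-- An upper bound for the number of operations of the solver. -/
def operationBound (m n lam Δ : ℕ) : ℕ :=
  n * 40 + 40 + (m * (n * (n * 49 + 82) + 46) + 6 +
    ((n + 1) * lam ^ 2 * (2 * n * Δ) ^ 2 * (n * (n * 22 + 54) + 35) + 6 + (n * 18 + 8)))

theorem solver_spec {m n : ℕ} (A : Matrix (Fin m) (Fin n) ℤ) (b : Fin m → ℤ) (lam : ℕ)
    (hn : 1 ≤ n) (hlam : 1 ≤ lam) (hA : (A.map (Int.cast : ℤ → ℝ)).rank = m)
    (hfeas : feasibleSet A b lam = ∅ ∨ (strictlyFeasibleSet A b lam).Nonempty) :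
    Ends solver (inputState A b lam (maxSubdet A)) (operationBound m n lam (maxSubdet A)) fun s =>
      (verdict s = 1 ∧ returnedPoint n s ∈ feasibleSet A b lam) ∨
        (verdict s = 0 ∧ feasibleSet A b lam = ∅) := by
  set Δ := maxSubdet A with hΔ
  have hΔ1 : (0 : ℚ) < Δ := by exact_mod_cast one_le_maxSubdet hA
  have hn0 : (0 : ℚ) < n := by exact_mod_cast hn
  have hlam0 : (0 : ℚ) < lam := by exact_mod_cast hlam
  set s := inputState A b lam Δ with hs
  set δ : ℚ := 1 / (2 * n * Δ) with hδ
  have hδ0 : 0 < δ := by positivity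
  refine ends_seq ((prepare_spec A b lam Δ).mono ?_ le_rfl)
  rintro s₁ ⟨hF₁, h4, h7, h8⟩
  refine ends_seq ((projectAll_spec (A := A.map (Int.cast : ℤ → ℚ)) (b := fun i => (b i : ℚ))
    (exists_mulVec_eq_single hA) ?_ ?_ ?_ ?_ ?_ ?_).mono ?_ le_rfl)
  · rw [hF₁.idx 0 (by decide)]; rfl
  · rw [hF₁.idx 1 (by decide)]; rfl
  · intro i j
    rw [hF₁.arr 0 (by decide)]
    simp [inputState]
  · intro i
    rw [hF₁.arr 1 (by decide)]
    simp [inputState]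
  · intro j
    rw [hF₁.arr 3 (by decide)]
    simp [inputState]
  · intro j k
    rw [h4, Matrix.one_apply]
    simp [Fin.ext_iff]
  rintro s₂ ⟨hF₂, P, x, hP, hx, hS⟩
  have h8' : s₂.arr 8 0 0 = n * lam ^ 2 + lam ^ 2 := by rw [hF₂.arr 8 (by decide), h8]
  -- The number of sweeps `K` is the initial potential `(n + 1) * lam ^ 2` divided by `δ ^ 2`; the
  -- extra `lam ^ 2` beyond `n * lam ^ 2` is the slack `ε`.
  refine ends_seq ((relax_spec (lam := lam) (δ := δ) (ε := (lam : ℚ) ^ 2)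
    (K := (n + 1) * lam ^ 2 * (2 * n * Δ) ^ 2) hS hδ0 ?_ ?_ ?_ ?_ hP hx
    (funext fun i => hS.sol i i.2) (by positivity) ?_ ?_).mono ?_ le_rfl)
  · rw [hF₂.idx 1 (by decide), hF₁.idx 1 (by decide)]; rfl
  · rw [hF₂.arr 2 (by decide), hF₁.arr 2 (by decide)]; rfl
  · rw [hF₂.idx 5 (by decide), hF₁.idx 5 (by decide)]; rfl
  · rw [hF₂.arr 7 (by decide), h7]
  · intro y hy
    rw [h8']
    have h1 := hS.dist y hy.1
    -- A central point lies in the box, and the starting point is no farther from it than the origin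
    -- is.
    have h2 : y ⬝ᵥ y ≤ ∑ _j : Fin n, (lam : ℚ) ^ 2 := Finset.sum_le_sum fun j _ => by
      have := hy.2 j
      nlinarith
    simp only [Finset.sum_const, Finset.card_univ, Fintype.card_fin, nsmul_eq_mul] at h2
    linarith
  · rw [h8', hδ]
    push_cast
    apply le_of_eq
    field_simp
  rintro s₃ ⟨h1, x', hx', hAx', hflag⟩
  refine (output_spec h1).mono ?_ le_rfl
  rintro s₄ ⟨h0, hout⟩
  have hpt : ∀ j, returnedPoint n s₄ j = (x' j : ℝ) := fun j => by
    rw [returnedPoint, hout j j.2, hx' j]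
  rcases hflag with ⟨h5, hbox⟩ | ⟨h5, hno⟩
  · refine Or.inl ⟨h0.trans h5, ?_, fun j => ?_⟩
    · ext i
      have := congrFun hAx' i
      simp only [Matrix.mulVec, dotProduct, Matrix.map_apply, hpt] at this ⊢
      exact_mod_cast this
    · rw [hpt]
      exact_mod_cast hbox j
  · refine Or.inr ⟨h0.trans h5, hfeas.resolve_right fun hne => ?_⟩
    obtain ⟨y, hy, hy'⟩ := exists_central_point hn hA hne
    exact hno y ⟨hy, hy'⟩

/-- Since `(7/5)² = 49/25 ≤ 2`, the logarithm is at most `1/2`. This makes a sweep count quadratic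
in `B` affordable. -/
theorem two_le_inv_logb : 2 ≤ 1 / Real.logb 2 (7 / 5) := by
  have h0 : 0 < Real.logb 2 (7 / 5) := Real.logb_pos (by norm_num) (by norm_num)
  rw [le_div_iff₀ h0]
  have h1 : 2 * Real.logb 2 (7 / 5) = Real.logb 2 ((7 / 5) ^ 2) := by
    rw [Real.logb_pow]; norm_num
  rw [h1, ← Real.logb_self_eq_one (b := 2) (by norm_num)]
  exact Real.logb_le_logb_of_le (by norm_num) (by norm_num) (by norm_num)

/-- Since `n` and `B` are at least 1, all lower-order terms are absorbed by `B² n²`: the sweeps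
contribute `22 + 54 + 35 = 111` and the terms without `m` outside them `58 + 60 = 118`, together
229. The terms with `m` need only 177. The logarithms are merely nonnegative. -/
theorem operationBound_le (m : ℕ) {n lam Δ : ℕ} (hn : 1 ≤ n) (hlam : 1 ≤ lam) (hΔ : 1 ≤ Δ) :
    (operationBound m n lam Δ : ℝ) ≤ 229 * timeBound m n lam Δ := by
  have hn' : (1 : ℝ) ≤ n := by exact_mod_cast hn
  have hlam' : (1 : ℝ) ≤ lam := by exact_mod_cast hlam
  have hΔ' : (1 : ℝ) ≤ Δ := by exact_mod_cast hΔ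
  set B : ℝ := 2 * n * Δ * lam * Real.sqrt (2 * n + 1) with hB
  have hB2 : B ^ 2 = (2 * n * Δ * lam) ^ 2 * (2 * n + 1) := by
    rw [hB, mul_pow, Real.sq_sqrt (by positivity)]
  have hbase : 1 ≤ 2 * (n : ℝ) * Δ * lam := by
    have h1 : 1 ≤ (n : ℝ) * Δ := one_le_mul_of_one_le_of_one_le hn' hΔ'
    have h2 : 1 ≤ (n : ℝ) * Δ * lam := one_le_mul_of_one_le_of_one_le h1 hlam'
    linarith
  have hB1 : 1 ≤ B :=
    one_le_mul_of_one_le_of_one_le hbase (Real.one_le_sqrt.2 (by linarith))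
  have hpow : B ^ 2 ≤ B ^ (1 / Real.logb 2 (7 / 5)) := by
    rw [← Real.rpow_two]
    exact Real.rpow_le_rpow_of_exponent_le hB1 two_le_inv_logb
  have hK : ((n : ℝ) + 1) * lam ^ 2 * (2 * n * Δ) ^ 2 ≤ B ^ 2 := by
    rw [hB2]
    have : (n : ℝ) + 1 ≤ 2 * n + 1 := by linarith
    calc ((n : ℝ) + 1) * lam ^ 2 * (2 * n * Δ) ^ 2 = (2 * n * Δ * lam) ^ 2 * (n + 1) := by ring
      _ ≤ _ := by gcongr
  have hB21 : 1 ≤ B ^ 2 := one_le_pow₀ hB1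
  have hlog : (n : ℝ) ^ 2 ≤ (n : ℝ) ^ 2 + n * Real.log Δ + n * Real.log lam := by
    have := mul_nonneg (zero_le_one.trans hn') (Real.log_nonneg hΔ')
    have := mul_nonneg (zero_le_one.trans hn') (Real.log_nonneg hlam')
    linarith
  have hmain : B ^ 2 * (n : ℝ) ^ 2 ≤ B ^ (1 / Real.logb 2 (7 / 5)) *
      ((n : ℝ) ^ 2 + n * Real.log Δ + n * Real.log lam) := by gcongr
  have hn2 : (n : ℝ) ≤ (n : ℝ) ^ 2 := by nlinarith
  have hn21 : (1 : ℝ) ≤ (n : ℝ) ^ 2 := hn'.trans hn2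
  have h1 : (m : ℝ) * (n * (n * 49 + 82) + 46) ≤ m * (177 * (n : ℝ) ^ 2) := by
    gcongr
    linarith
  have h2 : ((n : ℝ) + 1) * lam ^ 2 * (2 * n * Δ) ^ 2 * (n * (n * 22 + 54) + 35) ≤
      B ^ 2 * (111 * (n : ℝ) ^ 2) := by
    gcongr
    linarith
  have h3 : (n : ℝ) ^ 2 ≤ B ^ 2 * (n : ℝ) ^ 2 := le_mul_of_one_le_left (by positivity) hB21
  have hm3 : (0 : ℝ) ≤ (m : ℝ) ^ 3 := by positivity
  have hm2 : (0 : ℝ) ≤ (m : ℝ) ^ 2 * n := by positivity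
  have hm1 : (0 : ℝ) ≤ (n : ℝ) ^ 2 * m := by positivity
  rw [operationBound, timeBound, ← hB]
  push_cast
  linarith

end BoundedLP

theorem mainTheorem4 :
    ∃ (p : ArithRAM.Program) (C : ℝ),
      ∀ (m n : ℕ) (A : Matrix (Fin m) (Fin n) ℤ) (b : Fin m → ℤ) (lam : ℕ),
        1 ≤ n → 1 ≤ lam →
        (A.map (Int.cast : ℤ → ℝ)).rank = m →
        (BoundedLP.feasibleSet A b lam = ∅ ∨ (BoundedLP.strictlyFeasibleSet A b lam).Nonempty) →
        ∃ (t : ℕ) (s : ArithRAM.State),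
          ArithRAM.Run p (BoundedLP.inputState A b lam (BoundedLP.maxSubdet A)) t s ∧
          (t : ℝ) ≤ C * BoundedLP.timeBound m n lam (BoundedLP.maxSubdet A) ∧
          ((BoundedLP.verdict s = 1 ∧
              BoundedLP.returnedPoint n s ∈ BoundedLP.feasibleSet A b lam) ∨
            (BoundedLP.verdict s = 0 ∧ BoundedLP.feasibleSet A b lam = ∅)) := by
  refine ⟨BoundedLP.solver, 229, fun m n A b lam hn hlam hA hfeas => ?_⟩
  obtain ⟨t, s, hrun, ht, hs⟩ := BoundedLP.solver_spec A b lam hn hlam hA hfeas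
  refine ⟨t, s, hrun, ?_, hs⟩
  exact (Nat.cast_le.2 ht).trans
    (BoundedLP.operationBound_le m hn hlam (BoundedLP.one_le_maxSubdet hA))
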